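/- **Theorem.** Fix a real number $d>1$. In the uniform Leaky-ASM on $\mathbb Z^2$ a site can topple when it has at least $4d$ chips; when it topples it loses $4d$ chips and each of its four nearest neighbours receives one chip (so $4(d-1)$ chips leak). Start with $n$ chips at the origin and none elsewhere, and topple until no site can topple. Let $D_{n,d}\subset\mathbb Z^2$ be the set of sites that topple during this stabilization, let $\partial D_{n,d}$ be the set of sites of $D_{n,d}$ with at least one nearest neighbour outside $D_{n,d}$, and let $r=r_n=\log n-\frac12\log\log n$. Let $P(z,w)=\dfrac{4d-z-z^{-1}-w-w^{-1}}{4(d-1)}$. Its amoeba is the set of all $(\log|z|,\log|w|)$ with $z,w\in\mathbb C\setminus\{0\}$ and $P(z,w)=0$, and its gaseous phase is the bounded component of the complement of the amoeba. The dual of a curve $(x(t),y(t))$ is the curve $\frac1{Q(t)}(y'(t),-x'(t))$ with $Q=yx'-xy'$. Let $\Gamma_d$ be the dual of the boundary of the gaseous phase. 1. As $n\to\infty$, the rescaled boundary $r^{-1}\,\partial D_{n,d}$ converges to $\Gamma_d$ in the Hausdorff distance. 2. $\Gamma_d$ consists of the arc $$-\left(\frac1{S(w_+)},\frac a{S(w_+)}\right),\qquad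 0\le a\le1,$$ and its images under the reflections in the coordinate axes and in the diagonal $y=x$ and their compositions. Here $S(w)=-\log z_+(w)-a\log w$ with $$z_+(w)=\tfrac12\left(4d-w-\tfrac1w+\sqrt{(4d-w-\tfrac1w)^2-4}\right),$$ and $w_+=w_+(a,d)$ is the critical point of $S$ given by $$w_+=\frac{-2a^2d+u_++2a\sqrt{d^2(1+a^2)-d\,u_+}}{1-a^2},\qquad u_+=\sqrt{4a^2d^2+(1-a^2)^2},$$ for $0\le a<1$, and by the limit $w_+=d+\sqrt{d^2-1}$ for $a=1$. 3. There is a constant $h(d)>0$, depending only on $d$, such that for all sufficiently large $n$: every point of $\partial D_{n,d}$ is within distance $h(d)$ of the scaled curve $r\,\Gamma_d$, and every point of $r\,\Gamma_d$ is within distance $h(d)$ of $\partial D_{n,d}$. Moreover, in every direction the visited region ends within distance $h(d)$ of the scaled curve: if a site $x\in\mathbb Z^2$ lies on the ray from the origin through $q\in\Gamma_d$, then $x\in D_{n,d}$ whenever $|x|\le r|q|-h(d)$, and $x\notin D_{n,d}$ whenever $|x|>r|q|+h(d)$. -/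

import Mathlib

open Filter Topology Set
open scoped Pointwise

noncomputable section

namespace LeakySandpile

/-! ### The uniform leaky abelian sandpile -/

/-- Sites of the square lattice. -/
abbrev Site : Type := ℤ × ℤ

/-- A sandpile: a real amount of sand at every site. -/
abbrev Sandpile : Type := Site → ℝ

/-- The sandpile with `n` chips at the origin and none elsewhere. -/
def pointPile (n : ℕ) : Sandpile := fun y => if y = (0, 0) then (n : ℝ) else 0

/-- One toppling of the uniform Leaky-ASM at `x`: the site `x` loses `4 d` chips, each of its four
nearest neighbours receives one chip (so `4 (d - 1)` chips leak). -/
def topple (d : ℝ) (s : Sandpile) (x : Site) : Sandpile := fun y =>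
  s y - (if y = x then 4 * d else 0)
    + (if y = (x.1 + 1, x.2) then 1 else 0) + (if y = (x.1 - 1, x.2) then 1 else 0)
    + (if y = (x.1, x.2 + 1) then 1 else 0) + (if y = (x.1, x.2 - 1) then 1 else 0)

/-- The sandpile after toppling the sites of the list, in that order. -/
def run (d : ℝ) (s : Sandpile) : List Site → Sandpile
  | [] => s
  | x :: l => run d (topple d s x) l

/-- Every site of the list has at least `4 d` chips at the moment when it topples. -/
def IsLegal (d : ℝ) (s : Sandpile) : List Site → Prop
  | [] => True
  | x :: l => 4 * d ≤ s x ∧ IsLegal d (topple d s x) l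

/-- No site can topple. -/
def IsStable (d : ℝ) (s : Sandpile) : Prop := ∀ x, s x < 4 * d

/-- The list is a complete stabilization process: legal topplings that end in a stable sandpile. -/
def IsStabilization (d : ℝ) (s : Sandpile) (l : List Site) : Prop :=
  IsLegal d s l ∧ IsStable d (run d s l)

/-- The set of visited sites: those that topple during the stabilization of `n` chips at the
origin. A stabilization process exists, and the set does not depend on which one is chosen: see
`exists_isStabilization` and `visited_eq` below. -/
def visited (d : ℝ) (n : ℕ) : Set Site :=
  {x | ∃ l, IsStabilization d (pointPile n) l ∧ x ∈ l}

theorem run_append_singleton (d : ℝ) (l : List Site) (x : Site) :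
    ∀ s, run d s (l ++ [x]) = topple d (run d s l) x := by
  induction l with
  | nil => intro s; rfl
  | cons y l ih => intro s; exact ih _

theorem isLegal_append_singleton (d : ℝ) (l : List Site) (x : Site) :
    ∀ s, IsLegal d s (l ++ [x]) ↔ IsLegal d s l ∧ 4 * d ≤ run d s l x := by
  induction l with
  | nil => intro s; simp [IsLegal, run]
  | cons y l ih => intro s; simp [IsLegal, run, ih, and_assoc]

theorem run_apply (d : ℝ) (l : List Site) (y : Site) : ∀ s, run d s l y =
    s y - 4 * d * (l.count y : ℝ)
      + (l.count (y.1 - 1, y.2) : ℝ) + (l.count (y.1 + 1, y.2) : ℝ)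
      + (l.count (y.1, y.2 - 1) : ℝ) + (l.count (y.1, y.2 + 1) : ℝ) := by
  induction l with
  | nil => intro s; simp [run]
  | cons x l ih =>
    intro s
    obtain ⟨x1, x2⟩ := x
    obtain ⟨y1, y2⟩ := y
    have e1 : (y1 = x1 + 1) = (x1 = y1 - 1) := by apply propext; omega
    have e2 : (y1 = x1 - 1) = (x1 = y1 + 1) := by apply propext; omega
    have e3 : (y2 = x2 + 1) = (x2 = y2 - 1) := by apply propext; omega
    have e4 : (y2 = x2 - 1) = (x2 = y2 + 1) := by apply propext; omega
    have e5 : (y1 = x1) = (x1 = y1) := by apply propext; omega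
    have e6 : (y2 = x2) = (x2 = y2) := by apply propext; omega
    have hm : ∀ p : Prop, ∀ [Decidable p],
        (if p then 4 * d else 0) = 4 * d * (if p then (1 : ℝ) else 0) := by
      intro p _; split_ifs <;> simp
    rw [run, ih]
    simp only [topple, List.count_cons, Prod.mk.injEq, beq_iff_eq, Nat.cast_add, Nat.cast_ite,
      Nat.cast_one, Nat.cast_zero, e1, e2, e3, e4, e5, e6, hm]
    ring

/-- Least action principle. -/
theorem count_le_count (d : ℝ) (s : Sandpile) (m : List Site) (hm : IsStable d (run d s m))
    (l : List Site) (hl : IsLegal d s l) : ∀ x, l.count x ≤ m.count x := by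
  induction l using List.reverseRecOn with
  | nil => simp
  | append_singleton l x ih =>
    rw [isLegal_append_singleton] at hl
    have ih := ih hl.1
    intro y
    rw [List.count_append, List.count_singleton]
    by_cases hxy : x = y
    · subst hxy
      by_contra hcon
      have he : l.count x = m.count x := by
        have := ih x
        simp at hcon
        omega
      have h1 := hm x
      have h2 := hl.2
      rw [run_apply] at h1 h2
      rw [he] at h2
      have c1 : (l.count (x.1 - 1, x.2) : ℝ) ≤ m.count (x.1 - 1, x.2) := by exact_mod_cast ih _
      have c2 : (l.count (x.1 + 1, x.2) : ℝ) ≤ m.count (x.1 + 1, x.2) := by exact_mod_cast ih _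
      have c3 : (l.count (x.1, x.2 - 1) : ℝ) ≤ m.count (x.1, x.2 - 1) := by exact_mod_cast ih _
      have c4 : (l.count (x.1, x.2 + 1) : ℝ) ≤ m.count (x.1, x.2 + 1) := by exact_mod_cast ih _
      linarith
    · simpa [hxy] using ih y

/-- The visited set is the set of sites toppled by any one stabilization process. -/
theorem visited_eq (d : ℝ) (n : ℕ) (l : List Site) (hl : IsStabilization d (pointPile n) l) :
    visited d n = {x | x ∈ l} := by
  ext x
  constructor
  · rintro ⟨m, hm, hx⟩
    have := count_le_count d _ l hl.2 m hm.1 x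
    have h0 := List.count_pos_iff.2 hx
    exact List.count_pos_iff.1 (by omega)
  · exact fun hx => ⟨l, hl, hx⟩

theorem hasSum_topple (d : ℝ) (s : Sandpile) (x : Site) (M : ℝ) (h : HasSum s M) :
    HasSum (topple d s x) (M - 4 * (d - 1)) := by
  have H := ((((h.sub (hasSum_ite_eq x (4 * d))).add (hasSum_ite_eq (x.1 + 1, x.2) (1 : ℝ))).add
    (hasSum_ite_eq (x.1 - 1, x.2) (1 : ℝ))).add (hasSum_ite_eq (x.1, x.2 + 1) (1 : ℝ))).add
    (hasSum_ite_eq (x.1, x.2 - 1) (1 : ℝ))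
  have e : M - 4 * (d - 1) = M - 4 * d + 1 + 1 + 1 + 1 := by ring
  rw [e]
  exact H

theorem length_le (d : ℝ) (l : List Site) : ∀ (s : Sandpile) (M : ℝ), (∀ y, 0 ≤ s y) →
    HasSum s M → IsLegal d s l → 4 * (d - 1) * (l.length : ℝ) ≤ M := by
  induction l with
  | nil => intro s M h0 hs _; simpa using hs.nonneg h0
  | cons x l ih =>
    intro s M h0 hs hl
    have hn : ∀ y, 0 ≤ topple d s x y := by
      intro y
      have hy : 0 ≤ s y - (if y = x then 4 * d else 0) := by
        by_cases h : y = x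
        · subst h; simpa using hl.1
        · simpa [h] using h0 y
      unfold topple
      have hi : ∀ p : Prop, ∀ [Decidable p], (0 : ℝ) ≤ if p then 1 else 0 := by
        intro p _; split_ifs <;> norm_num
      have := hi (y = (x.1 + 1, x.2))
      have := hi (y = (x.1 - 1, x.2))
      have := hi (y = (x.1, x.2 + 1))
      have := hi (y = (x.1, x.2 - 1))
      linarith
    have := ih _ _ hn (hasSum_topple d s x M hs) hl.2
    push_cast [List.length_cons]
    linarith

/-- Toppling `n` chips at the origin always terminates in a stable sandpile. -/
theorem exists_isStabilization (d : ℝ) (hd : 1 < d) (n : ℕ) :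
    ∃ l, IsStabilization d (pointPile n) l := by
  by_contra hcon
  have key : ∀ k : ℕ, ∃ l : List Site, IsLegal d (pointPile n) l ∧ l.length = k := by
    intro k
    induction k with
    | zero => exact ⟨[], trivial, rfl⟩
    | succ k ih =>
      obtain ⟨l, hl, hk⟩ := ih
      have hns : ¬ IsStable d (run d (pointPile n) l) := fun h => hcon ⟨l, hl, h⟩
      simp only [IsStable, not_forall, not_lt] at hns
      obtain ⟨x, hx⟩ := hns
      exact ⟨l ++ [x], (isLegal_append_singleton d l x _).2 ⟨hl, hx⟩, by simp [hk]⟩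
  obtain ⟨k, hk⟩ := exists_nat_gt ((n : ℝ) / (4 * (d - 1)))
  obtain ⟨l, hl, hlk⟩ := key k
  have h0 : ∀ y, 0 ≤ pointPile n y := by
    intro y; unfold pointPile; split_ifs <;> simp
  have := length_le d l (pointPile n) n h0 (hasSum_ite_eq (0, 0) (n : ℝ)) hl
  rw [div_lt_iff₀ (by linarith), ← hlk] at hk
  linarith

/-! ### Boundary and scaling -/

/-- The Euclidean plane. -/
abbrev Plane : Type := EuclideanSpace ℝ (Fin 2)

/-- The inclusion of the lattice into the plane. -/
def toPlane (x : Site) : Plane := !₂[(x.1 : ℝ), (x.2 : ℝ)]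

/-- The boundary of a set of sites: its sites with at least one of their four nearest neighbours
outside the set, as a subset of the plane. -/
def latticeBoundary (D : Set Site) : Set Plane :=
  toPlane '' {x | x ∈ D ∧ ((x.1 + 1, x.2) ∉ D ∨ (x.1 - 1, x.2) ∉ D ∨
    (x.1, x.2 + 1) ∉ D ∨ (x.1, x.2 - 1) ∉ D)}

/-- The scale `log n - (1/2) log log n`. -/
def scale (n : ℕ) : ℝ := Real.log n - 1 / 2 * Real.log (Real.log n)

/-! ### Amoebae and dual curves -/

/-- The zero set in `(ℂ ∖ {0})²` of a Laurent polynomial, given as a function. -/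
def spectralCurve (P : ℂ → ℂ → ℂ) : Set (ℂ × ℂ) :=
  {q | q.1 ≠ 0 ∧ q.2 ≠ 0 ∧ P q.1 q.2 = 0}

/-- The amoeba: the image of the spectral curve under `(z, w) ↦ (log |z|, log |w|)`. -/
def amoeba (P : ℂ → ℂ → ℂ) : Set Plane :=
  (fun q : ℂ × ℂ => (!₂[Real.log ‖q.1‖, Real.log ‖q.2‖] : Plane)) '' spectralCurve P

/-- The gaseous phase: the points of the complement of the amoeba whose connected component in that
complement is bounded. -/
def gaseousPhase (P : ℂ → ℂ → ℂ) : Set Plane :=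
  {x | x ∈ (amoeba P)ᶜ ∧ Bornology.IsBounded (connectedComponentIn (amoeba P)ᶜ x)}

/-- The dual of a plane curve: the points `(1/Q) (y', -x')` with `Q = y x' - x y'`, where `(x, y)`
runs over the local parametrizations of the curve and their parameters `t` (with `Q ≠ 0`).
Equivalently, the `p` for which `{q | p ⬝ q = -1}` is a tangent line of the curve. -/
def dualCurve (C : Set Plane) : Set Plane :=
  {p | ∃ (x y : ℝ → ℝ) (t x' y' : ℝ), (∀ᶠ u in 𝓝 t, (!₂[x u, y u] : Plane) ∈ C) ∧
    HasDerivAt x x' t ∧ HasDerivAt y y' t ∧ y t * x' - x t * y' ≠ 0 ∧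
    p = (1 / (y t * x' - x t * y')) • (!₂[y', -x'] : Plane)}

/-- The Laurent polynomial of the uniform Leaky-ASM. -/
def spectralPoly (d : ℝ) (z w : ℂ) : ℂ :=
  (4 * (d : ℂ) - z - z⁻¹ - w - w⁻¹) / (4 * ((d : ℂ) - 1))

/-- The limit shape: the dual of the boundary of the gaseous phase. -/
def limitCurve (d : ℝ) : Set Plane :=
  dualCurve (frontier (gaseousPhase (spectralPoly d)))

/-! ### The explicit parametrization -/

/-- The larger root `z` of `P(z, w) = 0`, for real `w`. -/
def zPlus (d w : ℝ) : ℝ :=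
  ((4 * d - w - 1 / w) + √((4 * d - w - 1 / w) ^ 2 - 4)) / 2

/-- `S(w) = - log z₊(w) - a log w`, for real `w`. -/
def S (d a w : ℝ) : ℝ := -Real.log (zPlus d w) - a * Real.log w

/-- `u₊ = √(4 a² d² + (1 - a²)²)`. -/
def uPlus (d a : ℝ) : ℝ := √(4 * a ^ 2 * d ^ 2 + (1 - a ^ 2) ^ 2)

/-- The critical point `w₊` of `S`. The quotient is `0/0` at `a = 1`, where its limit is used. -/
def wPlus (d a : ℝ) : ℝ :=
  if a = 1 then d + √(d ^ 2 - 1)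
  else (-2 * a ^ 2 * d + uPlus d a + 2 * a * √(d ^ 2 * (1 + a ^ 2) - d * uPlus d a)) / (1 - a ^ 2)

/-- The arc `-(1 / S(w₊), a / S(w₊))`, `0 ≤ a ≤ 1`, together with its images under the reflections
generated by those in the coordinate axes and in the diagonal. -/
def explicitCurve (d : ℝ) : Set Plane :=
  {p | ∃ a ∈ Icc (0 : ℝ) 1, ∃ ε₁ ∈ ({1, -1} : Set ℝ), ∃ ε₂ ∈ ({1, -1} : Set ℝ),
    p = !₂[ε₁ * -(1 / S d a (wPlus d a)), ε₂ * -(a / S d a (wPlus d a))] ∨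
    p = !₂[ε₁ * -(a / S d a (wPlus d a)), ε₂ * -(1 / S d a (wPlus d a))]}

end LeakySandpile

end

noncomputable section

namespace LeakySandpile

/-! Let `u` count the topplings at each site and `A` sum over the four neighbours. Then `(4d - A) u`
is `n` times the unit mass at the origin minus the final pile, whose values lie in `[0, 4d)`. The
leak makes `4d - A` obey a minimum principle (`nonneg_of_superharmonic`). With `g` its Green
function, comparison gives `n g - d/(d-1) ≤ u ≤ n g`. Hence `n g ≥ 1` at visited sites and `n g ≤
d/(d-1)` at the others, so the visited set is a level set of `g` up to a bounded factor.

The second ingredient is `exists_green_bounds`: `g(x)` is comparable to `exp(-N(x)) / √|x|`, where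
`N = dualNorm d` is the support function of `cosh ξ + cosh η ≤ 2d`. In the coordinates `x + y`, `x -
y` a planar walk is a pair of independent walks on `ℤ`. Let `(ξ, η)` be the boundary point with
outer normal `x`. Tilting the two walks by `α = (ξ+η)/2` and `β = (ξ-η)/2` extracts `exp(-N(x))` and
absorbs the leak, because `cosh α cosh β = d`. The tilted pair drifts straight at `x`. The factor
`|x|^(-1/2)` comes from local binomial bounds: the lengths that matter form a window of order
`√|x|`, each contributing order `1/|x|`.

Taking logarithms, and using that `|x|` is of order `log n` near the boundary, places the boundary
where `N = log n - (1/2) log log n + O(1)` (`visited_sandwich`). So the visited set lies between two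
balls of `N` whose radii differ by a constant, and elementary lattice geometry gives the
constant-distance and Hausdorff statements.

For the curve itself, the gaseous phase is exactly `cosh ξ + cosh η < 2d` (`gaseousPhase_eq`), and
dualizing its boundary gives the unit sphere of `N` (`limitCurve_eq_sphere`). The explicit arc is
the same sphere: `-S(w₊)` is the value `N(1, a)`, with `w₊ = exp η` at the point of normal `(1, a)`.
-/

/-! ### The amoeba and its gaseous phase -/

/-- Half the sum `z + 1/z + w + 1/w` at `z = exp (p 0)`, `w = exp (p 1)`. -/
def coshSum (p : Plane) : ℝ := Real.cosh (p 0) + Real.cosh (p 1)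

theorem continuous_coshSum : Continuous coshSum := by
  unfold coshSum
  fun_prop

theorem spectralPoly_eq_zero_iff {d : ℝ} (hd : 1 < d) (z w : ℂ) :
    spectralPoly d z w = 0 ↔ z + z⁻¹ + (w + w⁻¹) = 4 * d := by
  have h : (4 * ((d : ℂ) - 1)) ≠ 0 := by
    have : ((d - 1 : ℝ) : ℂ) ≠ 0 := by
      rw [Ne, Complex.ofReal_eq_zero]
      linarith
    push_cast at this
    exact mul_ne_zero (by norm_num) this
  rw [spectralPoly, div_eq_zero_iff, or_iff_left h]
  constructor
  · intro h
    linear_combination -h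
  · intro h
    linear_combination -h

theorem exp_add_exp_inv (x θ : ℝ) :
    Complex.exp (x + θ * Complex.I) + (Complex.exp (x + θ * Complex.I))⁻¹ =
      ((2 * (Real.cosh x * Real.cos θ) : ℝ) : ℂ)
        + ((2 * (Real.sinh x * Real.sin θ) : ℝ) : ℂ) * Complex.I := by
  have h : Complex.exp (x + θ * Complex.I) + (Complex.exp (x + θ * Complex.I))⁻¹ =
      2 * Complex.cosh (x + θ * Complex.I) := by
    rw [Complex.cosh, ← Complex.exp_neg]
    ring
  rw [h, Complex.cosh_add, Complex.cosh_mul_I, Complex.sinh_mul_I]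
  push_cast
  ring

theorem mem_amoeba_iff {d : ℝ} (hd : 1 < d) (p : Plane) :
    p ∈ amoeba (spectralPoly d) ↔ ∃ θ φ : ℝ,
      Real.cosh (p 0) * Real.cos θ + Real.cosh (p 1) * Real.cos φ = 2 * d ∧
      Real.sinh (p 0) * Real.sin θ + Real.sinh (p 1) * Real.sin φ = 0 := by
  have key : ∀ x y θ φ : ℝ, spectralPoly d (Complex.exp (x + θ * Complex.I))
      (Complex.exp (y + φ * Complex.I)) = 0 ↔
      Real.cosh x * Real.cos θ + Real.cosh y * Real.cos φ = 2 * d ∧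
      Real.sinh x * Real.sin θ + Real.sinh y * Real.sin φ = 0 := by
    intro x y θ φ
    rw [spectralPoly_eq_zero_iff hd, exp_add_exp_inv, exp_add_exp_inv, Complex.ext_iff]
    simp only [Complex.add_re, Complex.add_im, Complex.ofReal_re, Complex.ofReal_im,
      Complex.re_ofReal_mul, Complex.im_ofReal_mul, Complex.I_re, Complex.I_im]
    have e1 : ((4 : ℂ) * (d : ℂ)).re = 4 * d := by simp
    have e2 : ((4 : ℂ) * (d : ℂ)).im = 0 := by simp
    rw [e1, e2]
    constructor
    · rintro ⟨h1, h2⟩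
      constructor <;> linarith
    · rintro ⟨h1, h2⟩
      constructor <;> linarith
  constructor
  · rintro ⟨⟨z, w⟩, ⟨hz, hw, hP⟩, rfl⟩
    refine ⟨z.arg, w.arg, ?_⟩
    have hz' : Complex.exp ((Real.log ‖z‖ : ℝ) + (z.arg : ℂ) * Complex.I) = z := by
      rw [Complex.exp_add, ← Complex.ofReal_exp, Real.exp_log (norm_pos_iff.2 hz)]
      exact Complex.norm_mul_exp_arg_mul_I z
    have hw' : Complex.exp ((Real.log ‖w‖ : ℝ) + (w.arg : ℂ) * Complex.I) = w := by
      rw [Complex.exp_add, ← Complex.ofReal_exp, Real.exp_log (norm_pos_iff.2 hw)]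
      exact Complex.norm_mul_exp_arg_mul_I w
    have := (key (Real.log ‖z‖) (Real.log ‖w‖) z.arg w.arg).1 (by rw [hz', hw']; exact hP)
    simpa using this
  · rintro ⟨θ, φ, h⟩
    refine ⟨(Complex.exp ((p 0 : ℝ) + θ * Complex.I), Complex.exp ((p 1 : ℝ) + φ * Complex.I)),
      ⟨Complex.exp_ne_zero _, Complex.exp_ne_zero _, (key _ _ _ _).2 h⟩, ?_⟩
    ext i
    fin_cases i <;> simp [Complex.norm_exp]

theorem two_mul_le_coshSum {d : ℝ} (hd : 1 < d) {p : Plane} (hp : p ∈ amoeba (spectralPoly d)) :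
    2 * d ≤ coshSum p := by
  obtain ⟨θ, φ, h, -⟩ := (mem_amoeba_iff hd p).1 hp
  unfold coshSum
  have h1 := mul_le_mul_of_nonneg_left (Real.cos_le_one θ) (Real.cosh_pos (p 0)).le
  have h2 := mul_le_mul_of_nonneg_left (Real.cos_le_one φ) (Real.cosh_pos (p 1)).le
  linarith

/-- Eliminating `θ` leaves an equation in `φ` alone. Since `cosh y < cosh x` also gives `|tanh y| ≤
|tanh x|`, a solution would need a point of the circle of radius `cosh y` about `2d` at distance at
least `cosh x` from the origin, but that distance never exceeds `2d + cosh y`. -/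
theorem no_angles {d x y : ℝ} (hd : 1 < d) (h : Real.cosh y + 2 * d < Real.cosh x) (θ φ : ℝ)
    (h1 : Real.cosh x * Real.cos θ + Real.cosh y * Real.cos φ = 2 * d)
    (h2 : Real.sinh x * Real.sin θ + Real.sinh y * Real.sin φ = 0) : False := by
  have hc := Real.cosh_sq x
  have hc' := Real.cosh_sq y
  have h1y := Real.one_le_cosh y
  have hφ := Real.sin_sq_add_cos_sq φ
  have hθ := Real.sin_sq_add_cos_sq θ
  have hcφ := Real.neg_one_le_cos φ
  set c := Real.cosh x
  set c' := Real.cosh y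
  set s := Real.sinh x
  set s' := Real.sinh y
  have hs : 0 < s ^ 2 := by nlinarith
  have e : s ^ 2 * (2 * d - c' * Real.cos φ) ^ 2 + c ^ 2 * (s' ^ 2 * Real.sin φ ^ 2)
      = c ^ 2 * s ^ 2 := by
    have e1 : 2 * d - c' * Real.cos φ = c * Real.cos θ := by linarith
    have e2 : s' * Real.sin φ = -(s * Real.sin θ) := by linarith
    rw [e1, ← mul_pow s', e2]
    linear_combination (c ^ 2 * s ^ 2) * hθ
  have h3 : c ^ 2 * s' ^ 2 ≤ s ^ 2 * c' ^ 2 := by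
    have : c' ^ 2 ≤ c ^ 2 := by nlinarith
    nlinarith
  have h4 : c ^ 2 * (s' ^ 2 * Real.sin φ ^ 2) ≤ s ^ 2 * (c' ^ 2 * Real.sin φ ^ 2) := by
    nlinarith [mul_le_mul_of_nonneg_right h3 (sq_nonneg (Real.sin φ))]
  have h5 : (2 * d - c' * Real.cos φ) ^ 2 + c' ^ 2 * Real.sin φ ^ 2 < c ^ 2 := by
    have : (2 * d - c' * Real.cos φ) ^ 2 + c' ^ 2 * Real.sin φ ^ 2
        = (2 * d + c') ^ 2 - 4 * d * c' * (1 + Real.cos φ) := by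
      linear_combination c' ^ 2 * hφ
    rw [this]
    have : 0 ≤ 4 * d * c' * (1 + Real.cos φ) :=
      mul_nonneg (by nlinarith) (by linarith)
    nlinarith
  nlinarith [mul_lt_mul_of_pos_left h5 hs]

theorem exists_angle {a b : ℝ} (h : a ^ 2 + b ^ 2 = 1) : ∃ θ, Real.cos θ = a ∧ Real.sin θ = b := by
  have hn : ‖(⟨a, b⟩ : ℂ)‖ = 1 := by
    rw [← sq_eq_sq₀ (norm_nonneg _) zero_le_one, Complex.sq_norm, Complex.normSq_mk]
    linarith
  refine ⟨Complex.arg ⟨a, b⟩, ?_, ?_⟩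
  · rw [Complex.cos_arg (by intro h0; simp [h0] at hn), hn]
    simp
  · rw [Complex.sin_arg, hn]
    simp

theorem exists_angles {d x y : ℝ} (hd : 1 < d) (h : 2 * d ≤ Real.cosh x + Real.cosh y)
    (hyx : Real.cosh y ≤ Real.cosh x) (hxy : Real.cosh x ≤ Real.cosh y + 2 * d) : ∃ θ φ : ℝ,
    Real.cosh x * Real.cos θ + Real.cosh y * Real.cos φ = 2 * d ∧
      Real.sinh x * Real.sin θ + Real.sinh y * Real.sin φ = 0 := by
  have hc := Real.cosh_sq x
  have h1y := Real.one_le_cosh y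
  set c := Real.cosh x
  set c' := Real.cosh y
  set s := Real.sinh x
  set s' := Real.sinh y
  have hc0 : 0 < c := by linarith
  have hs : s ≠ 0 := by
    rintro hs
    rw [hs] at hc
    nlinarith
  -- `f φ` is the value that the two equations force on `cos² θ + sin² θ`; it is at most 1 at `φ =
  -- 0` and at least 1 at `φ = π`, so some `φ` gives exactly 1.
  let f : ℝ → ℝ := fun φ => ((2 * d - c' * Real.cos φ) / c) ^ 2 + (-(s' * Real.sin φ) / s) ^ 2
  have hf : ContinuousOn f (Icc 0 Real.pi) := by
    apply Continuous.continuousOn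
    fun_prop
  have hf0 : f 0 ≤ 1 := by
    simp only [f, Real.cos_zero, Real.sin_zero]
    have : ((2 * d - c' * 1) / c) ^ 2 ≤ 1 := by
      rw [sq_le_one_iff_abs_le_one, abs_div, abs_of_pos hc0, div_le_one hc0, abs_le]
      constructor <;> linarith
    simpa using this
  have hf1 : 1 ≤ f Real.pi := by
    simp only [f, Real.cos_pi, Real.sin_pi]
    have : 1 ≤ ((2 * d - c' * (-1)) / c) ^ 2 := by
      have : 1 ≤ (2 * d - c' * (-1)) / c := by
        rw [le_div_iff₀ hc0]
        linarith
      nlinarith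
    simpa using this
  obtain ⟨φ, -, hφ⟩ := intermediate_value_Icc Real.pi_pos.le hf ⟨hf0, hf1⟩
  obtain ⟨θ, h1, h2⟩ := exists_angle hφ
  refine ⟨θ, φ, ?_, ?_⟩
  · rw [h1]
    field_simp
    ring
  · rw [h2]
    field_simp
    ring

theorem mem_amoeba_of_le {d : ℝ} (hd : 1 < d) {p : Plane} (h : 2 * d ≤ coshSum p)
    (h0 : Real.cosh (p 0) ≤ Real.cosh (p 1) + 2 * d)
    (h1 : Real.cosh (p 1) ≤ Real.cosh (p 0) + 2 * d) : p ∈ amoeba (spectralPoly d) := by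
  rw [mem_amoeba_iff hd]
  unfold coshSum at h
  rcases le_total (Real.cosh (p 1)) (Real.cosh (p 0)) with hle | hle
  · exact exists_angles hd h hle h0
  · obtain ⟨θ, φ, e1, e2⟩ := exists_angles hd (by linarith) hle h1
    exact ⟨φ, θ, by linarith, by linarith⟩

theorem notMem_amoeba_of_lt {d : ℝ} (hd : 1 < d) {p : Plane}
    (h : Real.cosh (p 1) + 2 * d < Real.cosh (p 0) ∨ Real.cosh (p 0) + 2 * d < Real.cosh (p 1)) :
    p ∉ amoeba (spectralPoly d) := by
  rw [mem_amoeba_iff hd]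
  rintro ⟨θ, φ, e1, e2⟩
  rcases h with h | h
  · exact no_angles hd h θ φ e1 e2
  · exact no_angles hd h φ θ (by linarith) (by linarith)

theorem not_isBounded_of_ray {s : Set Plane} {x v : Plane} (hv : v ≠ 0)
    (h : ∀ t : ℝ, 0 ≤ t → x + t • v ∈ s) :
    ¬ Bornology.IsBounded (connectedComponentIn s x) := by
  intro hb
  have hsub : (fun t : ℝ => x + t • v) '' Ici 0 ⊆ connectedComponentIn s x := by
    apply IsPreconnected.subset_connectedComponentIn
    · exact isPreconnected_Ici.image _ (by fun_prop)
    · exact ⟨0, by simp, by simp⟩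
    · rintro _ ⟨t, ht, rfl⟩
      exact h t ht
  obtain ⟨R, hR⟩ := (hb.subset hsub).exists_norm_le
  have hv' := norm_pos_iff.2 hv
  have hR0 : 0 ≤ R := (norm_nonneg x).trans (by simpa using hR x ⟨0, by simp, by simp⟩)
  have ht : 0 ≤ (R + ‖x‖ + 1) / ‖v‖ := by positivity
  have h1 := hR _ ⟨_, ht, rfl⟩
  have h2 : ‖((R + ‖x‖ + 1) / ‖v‖) • v‖ = R + ‖x‖ + 1 := by
    rw [norm_smul, Real.norm_of_nonneg ht, div_mul_cancel₀ _ hv'.ne']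
  have h3 := norm_sub_le (x + ((R + ‖x‖ + 1) / ‖v‖) • v) x
  rw [add_sub_cancel_left, h2] at h3
  linarith

theorem abs_le_cosh (x : ℝ) : |x| ≤ Real.cosh x := by
  rw [← Real.cosh_abs]
  have h1 := Real.add_one_le_exp |x|
  have h2 := Real.cosh_sq |x|
  have h3 : |x| ≤ Real.sinh |x| := Real.self_le_sinh_iff.2 (abs_nonneg x)
  have h4 := Real.cosh_pos |x|
  have h5 := abs_nonneg x
  nlinarith

theorem abs_le_of_coshSum_le {c : ℝ} {p : Plane} (h : coshSum p ≤ c) (i : Fin 2) : |p i| ≤ c := by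
  unfold coshSum at h
  have h0 := abs_le_cosh (p 0)
  have h1 := abs_le_cosh (p 1)
  have := abs_nonneg (p 0)
  have := abs_nonneg (p 1)
  fin_cases i <;> simp only [Fin.zero_eta, Fin.mk_one] <;> linarith

theorem isBounded_coshSum_le (c : ℝ) : Bornology.IsBounded {p : Plane | coshSum p ≤ c} := by
  refine isBounded_iff_forall_norm_le.2 ⟨√(c ^ 2 + c ^ 2), fun p hp => ?_⟩
  rw [EuclideanSpace.norm_eq, Fin.sum_univ_two]
  refine Real.sqrt_le_sqrt (add_le_add ?_ ?_) <;>
  · rw [Real.norm_eq_abs]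
    exact pow_le_pow_left₀ (abs_nonneg _) (abs_le_of_coshSum_le hp _) 2

/-- The level set `coshSum = 2d` lies in the amoeba (take both angles zero), so a component meeting
the sublevel set stays inside it and is bounded. Any other complement point has one coordinate whose
`cosh` exceeds the other by more than `2d`; moving that coordinate outward keeps this true, so its
component contains a ray. -/
theorem gaseousPhase_eq {d : ℝ} (hd : 1 < d) :
    gaseousPhase (spectralPoly d) = {p | coshSum p < 2 * d} := by
  ext p
  constructor
  · rintro ⟨hp, hb⟩
    by_contra hcon
    have hle : 2 * d ≤ coshSum p := not_lt.1 hcon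
    have hor : Real.cosh (p 1) + 2 * d < Real.cosh (p 0) ∨
        Real.cosh (p 0) + 2 * d < Real.cosh (p 1) := by
      by_contra! h
      exact hp (mem_amoeba_of_le hd hle h.1 h.2)
    rcases hor with h | h
    · refine not_isBounded_of_ray (v := !₂[p 0, 0]) ?_ (fun t ht => ?_) hb
      · intro h0
        have : p 0 = 0 := by simpa using congrArg (fun q : Plane => q 0) h0
        rw [this, Real.cosh_zero] at h
        have := Real.cosh_pos (p 1)
        linarith
      · refine notMem_amoeba_of_lt hd (Or.inl ?_)
        have : Real.cosh (p 0) ≤ Real.cosh (p 0 + t * p 0) := by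
          rw [Real.cosh_le_cosh, show p 0 + t * p 0 = (1 + t) * p 0 by ring, abs_mul]
          exact le_mul_of_one_le_left (abs_nonneg _) (by rw [abs_of_nonneg] <;> linarith)
        simp
        linarith
    · refine not_isBounded_of_ray (v := !₂[0, p 1]) ?_ (fun t ht => ?_) hb
      · intro h0
        have : p 1 = 0 := by simpa using congrArg (fun q : Plane => q 1) h0
        rw [this, Real.cosh_zero] at h
        have := Real.cosh_pos (p 0)
        linarith
      · refine notMem_amoeba_of_lt hd (Or.inr ?_)
        have : Real.cosh (p 1) ≤ Real.cosh (p 1 + t * p 1) := by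
          rw [Real.cosh_le_cosh, show p 1 + t * p 1 = (1 + t) * p 1 by ring, abs_mul]
          exact le_mul_of_one_le_left (abs_nonneg _) (by rw [abs_of_nonneg] <;> linarith)
        simp
        linarith
  · intro (hp : coshSum p < 2 * d)
    have hpA : p ∈ (amoeba (spectralPoly d))ᶜ := fun h => absurd (two_mul_le_coshSum hd h) (by linarith)
    refine ⟨hpA, (isBounded_coshSum_le (2 * d)).subset ?_⟩
    have : connectedComponentIn (amoeba (spectralPoly d))ᶜ p ⊆ {q | coshSum q < 2 * d} := by
      refine isPreconnected_connectedComponentIn.subset_left_of_subset_union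
        (v := {q | 2 * d < coshSum q}) (isOpen_lt continuous_coshSum continuous_const)
        (isOpen_lt continuous_const continuous_coshSum) ?_ ?_ ⟨p, mem_connectedComponentIn hpA, hp⟩
      · rw [Set.disjoint_left]
        intro q (h1 : coshSum q < 2 * d) (h2 : 2 * d < coshSum q)
        linarith
      · intro q hq
        rcases lt_trichotomy (coshSum q) (2 * d) with h | h | h
        · exact Or.inl h
        · exfalso
          refine connectedComponentIn_subset _ _ hq ((mem_amoeba_iff hd q).2 ⟨0, 0, ?_, ?_⟩)
          · simpa [coshSum] using h
          · simp
        · exact Or.inr h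
    exact fun q hq => le_of_lt (show coshSum q < 2 * d from this hq)

/-- Strictness makes each point of the level set a limit of points of the open sublevel set, hence a
frontier point. -/
theorem coshSum_smul_lt {p : Plane} (hp : p ≠ 0) {t : ℝ} (ht : t ∈ Ioo (0 : ℝ) 1) :
    coshSum (t • p) < coshSum p := by
  have hlt : ∀ x : ℝ, x ≠ 0 → Real.cosh (t * x) < Real.cosh x := by
    intro x hx
    rw [Real.cosh_lt_cosh, abs_mul, abs_of_pos ht.1]
    exact mul_lt_of_lt_one_left (abs_pos.2 hx) ht.2
  have hle : ∀ x : ℝ, Real.cosh (t * x) ≤ Real.cosh x := by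
    intro x
    by_cases hx : x = 0
    · simp [hx]
    · exact (hlt x hx).le
  simp only [coshSum, PiLp.smul_apply, smul_eq_mul]
  by_cases h0 : p 0 = 0
  · have h1 : p 1 ≠ 0 := by
      intro h1
      apply hp
      ext i
      fin_cases i <;> simp [h0, h1]
    exact add_lt_add_of_le_of_lt (hle _) (hlt _ h1)
  · exact add_lt_add_of_lt_of_le (hlt _ h0) (hle _)

theorem frontier_gaseousPhase {d : ℝ} (hd : 1 < d) :
    frontier (gaseousPhase (spectralPoly d)) = {p | coshSum p = 2 * d} := by
  rw [gaseousPhase_eq hd]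
  refine Subset.antisymm (frontier_lt_subset_eq continuous_coshSum continuous_const) ?_
  intro p (hp : coshSum p = 2 * d)
  rw [frontier, (isOpen_lt continuous_coshSum continuous_const).interior_eq]
  refine ⟨?_, fun h : coshSum p < 2 * d => by linarith⟩
  have hp0 : p ≠ 0 := by
    rintro rfl
    simp [coshSum] at hp
    linarith
  have ht : Tendsto (fun t : ℝ => t • p) (𝓝[<] 1) (𝓝 p) := by
    have : Tendsto (fun t : ℝ => t • p) (𝓝 1) (𝓝 ((1 : ℝ) • p)) :=
      (continuous_id.smul continuous_const).tendsto 1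
    rw [one_smul] at this
    exact this.mono_left nhdsWithin_le_nhds
  refine mem_closure_of_tendsto ht ?_
  filter_upwards [Ioo_mem_nhdsLT (show (0 : ℝ) < 1 by norm_num)] with t ht
  exact (coshSum_smul_lt hp0 ht).trans_eq hp

/-! ### The dual curve and the dual norm -/

theorem mul_sinh_pos {x : ℝ} (hx : x ≠ 0) : 0 < x * Real.sinh x := by
  rcases lt_or_gt_of_ne hx with h | h
  · exact mul_pos_of_neg_of_neg h (Real.sinh_neg_iff.2 h)
  · exact mul_pos h (Real.sinh_pos_iff.2 h)

theorem mul_sinh_nonneg (x : ℝ) : 0 ≤ x * Real.sinh x := by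
  by_cases hx : x = 0
  · simp [hx]
  · exact (mul_sinh_pos hx).le

theorem pairing_pos {d : ℝ} (hd : 1 < d) {x y : ℝ} (h : Real.cosh x + Real.cosh y = 2 * d) :
    0 < x * Real.sinh x + y * Real.sinh y := by
  by_cases hx : x = 0
  · have hy : y ≠ 0 := by
      rintro rfl
      rw [hx, Real.cosh_zero] at h
      linarith
    exact add_pos_of_nonneg_of_pos (mul_sinh_nonneg x) (mul_sinh_pos hy)
  · exact add_pos_of_pos_of_nonneg (mul_sinh_pos hx) (mul_sinh_nonneg y)

theorem exists_graph_of_pos {d x y : ℝ} (hy : 0 < y) (h : Real.cosh x + Real.cosh y = 2 * d) :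
    ∃ g : ℝ → ℝ, g x = y ∧ HasDerivAt g (-Real.sinh x / Real.sinh y) x ∧
      ∀ᶠ u in 𝓝 x, Real.cosh u + Real.cosh (g u) = 2 * d := by
  have h1 : 1 < 2 * d - Real.cosh x := by
    have : 1 < Real.cosh y := Real.one_lt_cosh.2 hy.ne'
    linarith
  have hxy : 2 * d - Real.cosh x = Real.cosh y := by linarith
  refine ⟨fun u => Real.arcosh (2 * d - Real.cosh u), ?_, ?_, ?_⟩
  · simp only
    rw [hxy, Real.arcosh_cosh hy.le]
  · have h2 := (Real.hasDerivAt_arcosh (x := 2 * d - Real.cosh x) h1).comp x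
      ((Real.hasDerivAt_cosh x).const_sub (2 * d))
    refine h2.congr_deriv ?_
    rw [hxy, show Real.cosh y ^ 2 - 1 = Real.sinh y ^ 2 by rw [Real.cosh_sq]; ring,
      Real.sqrt_sq (Real.sinh_pos_iff.2 hy).le]
    ring
  · have : ∀ᶠ u in 𝓝 x, 1 < 2 * d - Real.cosh u := by
      have hc : ContinuousAt (fun u => 2 * d - Real.cosh u) x := by fun_prop
      exact hc.eventually (lt_mem_nhds h1)
    filter_upwards [this] with u hu
    rw [Real.cosh_arcosh hu.le]
    ring

theorem exists_graph {d x y : ℝ} (hy : y ≠ 0) (h : Real.cosh x + Real.cosh y = 2 * d) :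
    ∃ g : ℝ → ℝ, g x = y ∧ HasDerivAt g (-Real.sinh x / Real.sinh y) x ∧
      ∀ᶠ u in 𝓝 x, Real.cosh u + Real.cosh (g u) = 2 * d := by
  rcases lt_or_gt_of_ne hy with hy | hy
  · obtain ⟨g, h1, h2, h3⟩ := exists_graph_of_pos (x := x) (y := -y) (d := d) (by linarith)
      (by rwa [Real.cosh_neg])
    refine ⟨fun u => -g u, by simp [h1], ?_, ?_⟩
    · refine h2.neg.congr_deriv ?_
      rw [Real.sinh_neg, div_neg, neg_neg]
    · filter_upwards [h3] with u hu
      rwa [Real.cosh_neg]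
  · exact exists_graph_of_pos hy h

/-- The velocity is orthogonal to the gradient `(sinh x, sinh y)`, so the dual point is the gradient
divided by minus its pairing with the point. The converse needs an actual local parametrization,
supplied by `exists_graph`. -/
theorem mem_dualCurve_level_iff {d : ℝ} (hd : 1 < d) (q : Plane) :
    q ∈ dualCurve {p | coshSum p = 2 * d} ↔ ∃ x y : ℝ, Real.cosh x + Real.cosh y = 2 * d ∧
      q = (x * Real.sinh x + y * Real.sinh y)⁻¹ • (!₂[Real.sinh x, Real.sinh y] : Plane) := by
  constructor
  · rintro ⟨x, y, t, x', y', hC, hx, hy, hQ, rfl⟩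
    have hC' : ∀ᶠ u in 𝓝 t, Real.cosh (x u) + Real.cosh (y u) = 2 * d := by
      filter_upwards [hC] with u hu
      simpa [coshSum] using hu
    have h0 := hC'.self_of_nhds
    have hder : Real.sinh (x t) * x' + Real.sinh (y t) * y' = 0 := by
      refine (hx.cosh.add hy.cosh).unique ?_
      exact (hasDerivAt_const t (2 * d)).congr_of_eventuallyEq hC'
    have hD := pairing_pos hd h0
    -- The dual point `p` of `q` satisfies `p ⬝ q = -1`; passing to the antipode absorbs the sign.
    refine ⟨-x t, -y t, by rwa [Real.cosh_neg, Real.cosh_neg], ?_⟩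
    simp only [Real.sinh_neg, neg_mul_neg]
    ext i
    fin_cases i
    · simp only [PiLp.smul_apply, smul_eq_mul, Fin.zero_eta, Fin.isValue,
        Matrix.cons_val_zero]
      field_simp
      linear_combination y t * hder
    · simp only [PiLp.smul_apply, smul_eq_mul, Fin.mk_one, Fin.isValue,
        Matrix.cons_val_one, Matrix.cons_val_zero]
      field_simp
      linear_combination -x t * hder
  · rintro ⟨x, y, h, rfl⟩
    have hD := pairing_pos hd h
    -- At `y = 0` the tangent is vertical, so the curve is a graph over the second coordinate
    -- instead of the first.
    by_cases hy : y = 0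
    · have hx : x ≠ 0 := by
        rintro rfl
        rw [hy] at hD
        simp at hD
      obtain ⟨g, h1, h2, h3⟩ := exists_graph (x := -y) (y := -x) (d := d) (neg_ne_zero.2 hx)
        (by rw [Real.cosh_neg, Real.cosh_neg]; linarith)
      have hs : Real.sinh x ≠ 0 := Real.sinh_ne_zero.2 hx
      have hQ : -y * (-Real.sinh (-y) / Real.sinh (-x)) - g (-y) * 1 =
          (x * Real.sinh x + y * Real.sinh y) / Real.sinh x := by
        rw [h1, Real.sinh_neg, Real.sinh_neg]
        field_simp
        ring
      refine ⟨g, fun u => u, -y, _, 1, ?_, h2, hasDerivAt_id _, ?_, ?_⟩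
      · filter_upwards [h3] with u hu
        simp [coshSum]
        linarith
      · rw [hQ]
        exact div_ne_zero hD.ne' hs
      · rw [hQ, Real.sinh_neg, Real.sinh_neg]
        generalize x * Real.sinh x + y * Real.sinh y = D at hD
        ext i
        fin_cases i
        · simp [inv_mul_eq_div]
        · simp
          field_simp
    · obtain ⟨g, h1, h2, h3⟩ := exists_graph (x := -x) (y := -y) (d := d) (neg_ne_zero.2 hy)
        (by rwa [Real.cosh_neg, Real.cosh_neg])
      have hs : Real.sinh y ≠ 0 := Real.sinh_ne_zero.2 hy
      have hQ : g (-x) * 1 - -x * (-Real.sinh (-x) / Real.sinh (-y)) =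
          -(x * Real.sinh x + y * Real.sinh y) / Real.sinh y := by
        rw [h1, Real.sinh_neg, Real.sinh_neg]
        field_simp
        ring
      refine ⟨fun u => u, g, -x, 1, _, ?_, hasDerivAt_id _, h2, ?_, ?_⟩
      · filter_upwards [h3] with u hu
        simpa [coshSum] using hu
      · rw [hQ]
        exact div_ne_zero (neg_ne_zero.2 hD.ne') hs
      · rw [hQ, Real.sinh_neg, Real.sinh_neg]
        generalize x * Real.sinh x + y * Real.sinh y = D at hD
        ext i
        fin_cases i
        · simp
          field_simp
        · simp
          field_simp

/-- The support function of the closure of the gaseous phase. -/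
def dualNorm (d : ℝ) (x : Plane) : ℝ :=
  sSup ((fun p : Plane => p 0 * x 0 + p 1 * x 1) '' {p | coshSum p ≤ 2 * d})

theorem cosh_add_sinh_mul_le (a b : ℝ) : Real.cosh a + Real.sinh a * (b - a) ≤ Real.cosh b := by
  have h1 : Real.exp a * (1 + (b - a)) ≤ Real.exp b := by
    have := mul_le_mul_of_nonneg_left (Real.add_one_le_exp (b - a)) (Real.exp_pos a).le
    rw [← Real.exp_add, add_sub_cancel] at this
    linarith
  have h2 : Real.exp (-a) * (1 - (b - a)) ≤ Real.exp (-b) := by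
    have := mul_le_mul_of_nonneg_left (Real.add_one_le_exp (a - b)) (Real.exp_pos (-a)).le
    rw [← Real.exp_add, show -a + (a - b) = -b by ring] at this
    linarith
  rw [Real.cosh_eq, Real.sinh_eq, Real.cosh_eq]
  linarith

/-- The linear functional `∇ coshSum (x, y)` is maximal over the sublevel set at `(x, y)`. -/
theorem pairing_le {d x y : ℝ} (h : Real.cosh x + Real.cosh y = 2 * d) {p : Plane}
    (hp : coshSum p ≤ 2 * d) :
    p 0 * Real.sinh x + p 1 * Real.sinh y ≤ x * Real.sinh x + y * Real.sinh y := by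
  have h1 := cosh_add_sinh_mul_le x (p 0)
  have h2 := cosh_add_sinh_mul_le y (p 1)
  unfold coshSum at hp
  linarith

theorem le_dualNorm {d : ℝ} {p : Plane} (hp : coshSum p ≤ 2 * d) (x : Plane) :
    p 0 * x 0 + p 1 * x 1 ≤ dualNorm d x := by
  refine le_csSup ⟨2 * d * |x 0| + 2 * d * |x 1|, ?_⟩ ⟨p, hp, rfl⟩
  rintro _ ⟨q, hq, rfl⟩
  have h : ∀ i, q i * x i ≤ 2 * d * |x i| := fun i =>
    (le_abs_self _).trans (by
      rw [abs_mul]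
      exact mul_le_mul_of_nonneg_right (abs_le_of_coshSum_le hq i) (abs_nonneg _))
  exact add_le_add (h 0) (h 1)

theorem dualNorm_le {d : ℝ} (hd : 1 < d) {x : Plane} {M : ℝ}
    (h : ∀ p : Plane, coshSum p ≤ 2 * d → p 0 * x 0 + p 1 * x 1 ≤ M) : dualNorm d x ≤ M := by
  refine csSup_le (Nonempty.image _ ⟨0, ?_⟩) ?_
  · simp [coshSum]
    linarith
  · rintro _ ⟨p, hp, rfl⟩
    exact h p hp

theorem dualNorm_smul {d : ℝ} (hd : 1 < d) {t : ℝ} (ht : 0 ≤ t) (x : Plane) :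
    dualNorm d (t • x) = t * dualNorm d x := by
  have key : ∀ {t : ℝ}, 0 ≤ t → ∀ x : Plane, dualNorm d (t • x) ≤ t * dualNorm d x := by
    intro t ht x
    refine dualNorm_le hd fun p hp => ?_
    have := mul_le_mul_of_nonneg_left (le_dualNorm hp x) ht
    simp only [PiLp.smul_apply, smul_eq_mul]
    linarith
  rcases ht.eq_or_lt with rfl | ht
  · rw [zero_smul, zero_mul]
    refine le_antisymm ((dualNorm_le hd fun p _ => by simp)) ?_
    have := le_dualNorm (p := 0) (d := d) (by simp [coshSum]; linarith) 0
    simpa using this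
  · refine le_antisymm (key ht.le x) ?_
    have := key (inv_pos.2 ht).le (t • x)
    rw [smul_smul, inv_mul_cancel₀ ht.ne', one_smul, inv_mul_eq_div, le_div_iff₀ ht] at this
    linarith

theorem dualNorm_add_le {d : ℝ} (hd : 1 < d) (x y : Plane) :
    dualNorm d (x + y) ≤ dualNorm d x + dualNorm d y := by
  refine dualNorm_le hd fun p hp => ?_
  have h1 := le_dualNorm hp x
  have h2 := le_dualNorm hp y
  simp only [PiLp.add_apply]
  linarith

/-- The gradient is an outer normal of a convex sublevel set, so the supremum is attained at the
point itself. -/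
theorem dualNorm_gradient {d x y : ℝ} (hd : 1 < d) (h : Real.cosh x + Real.cosh y = 2 * d) :
    dualNorm d !₂[Real.sinh x, Real.sinh y] = x * Real.sinh x + y * Real.sinh y := by
  refine le_antisymm (dualNorm_le hd fun p hp => ?_) ?_
  · simpa using pairing_le h hp
  · have := le_dualNorm (d := d) (p := !₂[x, y]) (by simpa [coshSum] using h.le)
      !₂[Real.sinh x, Real.sinh y]
    simpa using this

theorem dualNorm_swap {d : ℝ} (hd : 1 < d) (a b : ℝ) :
    dualNorm d !₂[a, b] = dualNorm d !₂[b, a] := by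
  have key : ∀ a b : ℝ, dualNorm d !₂[a, b] ≤ dualNorm d !₂[b, a] := by
    intro a b
    refine dualNorm_le hd fun p hp => ?_
    have := le_dualNorm (d := d) (p := !₂[p 1, p 0])
      (by unfold coshSum at hp ⊢; simpa [add_comm] using hp) !₂[b, a]
    simp at this ⊢
    linarith
  exact le_antisymm (key a b) (key b a)

theorem dualNorm_neg_left {d : ℝ} (hd : 1 < d) (a b : ℝ) :
    dualNorm d !₂[-a, b] = dualNorm d !₂[a, b] := by
  have key : ∀ a : ℝ, dualNorm d !₂[-a, b] ≤ dualNorm d !₂[a, b] := by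
    intro a
    refine dualNorm_le hd fun p hp => ?_
    have := le_dualNorm (d := d) (p := !₂[-p 0, p 1])
      (by unfold coshSum at hp ⊢; simpa using hp) !₂[a, b]
    simp at this ⊢
    linarith
  refine le_antisymm (key a) ?_
  have := key (-a)
  rwa [neg_neg] at this

theorem dualNorm_neg_right {d : ℝ} (hd : 1 < d) (a b : ℝ) :
    dualNorm d !₂[a, -b] = dualNorm d !₂[a, b] := by
  rw [dualNorm_swap hd, dualNorm_neg_left hd, dualNorm_swap hd]

theorem dualNorm_abs {d : ℝ} (hd : 1 < d) (a b : ℝ) :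
    dualNorm d !₂[|a|, |b|] = dualNorm d !₂[a, b] := by
  rcases abs_choice a with ha | ha <;> rcases abs_choice b with hb | hb <;> rw [ha, hb]
  · rw [dualNorm_neg_right hd]
  · rw [dualNorm_neg_left hd]
  · rw [dualNorm_neg_right hd, dualNorm_neg_left hd]

/-! ### The explicit parametrization -/

/-- `cosh` of the second coordinate of the point of the boundary of the gaseous phase with normal
`(1, a)`. -/
def coshTangent (d a : ℝ) : ℝ :=
  if a = 1 then d else (-2 * a ^ 2 * d + uPlus d a) / (1 - a ^ 2)

theorem uPlus_sq (d a : ℝ) : uPlus d a ^ 2 = 4 * a ^ 2 * d ^ 2 + (1 - a ^ 2) ^ 2 :=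
  Real.sq_sqrt (by positivity)

theorem one_sub_sq_pos {a : ℝ} (ha : a ∈ Icc (0 : ℝ) 1) (h1 : a ≠ 1) : 0 < 1 - a ^ 2 := by
  have := lt_of_le_of_ne ha.2 h1
  nlinarith [ha.1]

/-- These bounds keep both `cosh η` and `cosh ξ = 2d - cosh η` at least 1, so that `arcosh` inverts
them. -/
theorem coshTangent_bounds {d a : ℝ} (hd : 1 < d) (ha : a ∈ Icc (0 : ℝ) 1) :
    1 ≤ coshTangent d a ∧ coshTangent d a ≤ d := by
  unfold coshTangent
  split_ifs with h
  · exact ⟨hd.le, le_rfl⟩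
  · have h1 := one_sub_sq_pos ha h
    have h2 := sq_nonneg a
    rw [le_div_iff₀ h1, div_le_iff₀ h1]
    constructor
    · have : 1 - a ^ 2 + 2 * a ^ 2 * d ≤ uPlus d a := by
        refine Real.le_sqrt_of_sq_le ?_
        nlinarith [mul_nonneg (mul_nonneg h2 h1.le) (sub_nonneg.2 hd.le),
          mul_nonneg (mul_nonneg h2 h1.le) (sq_nonneg (d - 1))]
      linarith
    · have : uPlus d a ≤ d * (1 + a ^ 2) := by
        refine Real.sqrt_le_iff.2 ⟨by positivity, ?_⟩
        nlinarith [mul_nonneg (sq_nonneg (1 - a ^ 2)) (show 0 ≤ d ^ 2 - 1 by nlinarith)]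
      linarith

/-- This is the normal condition `sinh η = a sinh ξ`, squared, with `cosh ξ = 2d - cosh η`. -/
theorem coshTangent_eq {d a : ℝ} (ha : a ∈ Icc (0 : ℝ) 1) :
    coshTangent d a ^ 2 - 1 = a ^ 2 * ((2 * d - coshTangent d a) ^ 2 - 1) := by
  unfold coshTangent
  split_ifs with h
  · rw [h]
    ring
  · have h1 := (one_sub_sq_pos ha h).ne'
    have h2 := uPlus_sq d a
    field_simp
    linear_combination (1 - a ^ 2) * h2

/-- The radical in `wPlus` is a multiple of `√(cosh² η - 1) = sinh η`, which identifies `w₊` as `exp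
η`. -/
theorem wPlus_eq {d a : ℝ} (ha : a ∈ Icc (0 : ℝ) 1) :
    wPlus d a = coshTangent d a + √(coshTangent d a ^ 2 - 1) := by
  unfold wPlus coshTangent
  split_ifs with h
  · rfl
  · have h1 := one_sub_sq_pos ha h
    have h2 := uPlus_sq d a
    have e : ((-2 * a ^ 2 * d + uPlus d a) / (1 - a ^ 2)) ^ 2 - 1
        = (2 * a / (1 - a ^ 2)) ^ 2 * (d ^ 2 * (1 + a ^ 2) - d * uPlus d a) := by
      field_simp
      linear_combination h2
    rw [e, Real.sqrt_mul (sq_nonneg _), Real.sqrt_sq (div_nonneg (by linarith [ha.1]) h1.le)]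
    field_simp

/-- The point of the boundary of the gaseous phase with normal `(1, a)`. -/
theorem exists_tangent {d a : ℝ} (hd : 1 < d) (ha : a ∈ Icc (0 : ℝ) 1) : ∃ ξ η : ℝ,
    0 < ξ ∧ 0 ≤ η ∧ Real.cosh ξ + Real.cosh η = 2 * d ∧ Real.sinh η = a * Real.sinh ξ ∧
      wPlus d a = Real.exp η := by
  obtain ⟨h1, h2⟩ := coshTangent_bounds hd ha
  have h3 : 1 < 2 * d - coshTangent d a := by linarith
  refine ⟨Real.arcosh (2 * d - coshTangent d a), Real.arcosh (coshTangent d a),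
    Real.arcosh_pos h3, Real.arcosh_nonneg h1, ?_, ?_, ?_⟩
  · rw [Real.cosh_arcosh h1, Real.cosh_arcosh h3.le]
    ring
  · rw [Real.sinh_arcosh h1, Real.sinh_arcosh h3.le, coshTangent_eq ha,
      Real.sqrt_mul (sq_nonneg a), Real.sqrt_sq ha.1]
  · rw [Real.exp_arcosh h1, wPlus_eq ha]

theorem zPlus_exp {d ξ η : ℝ} (hξ : 0 ≤ ξ) (h : Real.cosh ξ + Real.cosh η = 2 * d) :
    zPlus d (Real.exp η) = Real.exp ξ := by
  have e : 4 * d - Real.exp η - 1 / Real.exp η = 2 * Real.cosh ξ := by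
    rw [one_div, ← Real.exp_neg]
    rw [Real.cosh_eq η] at h
    linarith
  rw [zPlus, e, show (2 * Real.cosh ξ) ^ 2 - 4 = (2 * Real.sinh ξ) ^ 2 by
    have := Real.cosh_sq ξ
    linear_combination 4 * this, Real.sqrt_sq (by
    have := Real.sinh_nonneg_iff.2 hξ
    linarith), ← Real.cosh_add_sinh]
  ring

theorem S_exp {d a ξ η : ℝ} (hξ : 0 ≤ ξ) (h : Real.cosh ξ + Real.cosh η = 2 * d) :
    S d a (Real.exp η) = -(ξ + a * η) := by
  rw [S, zPlus_exp hξ h, Real.log_exp, Real.log_exp]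
  ring

/-- The point `(ξ, η)` with normal `(1, a)` maximizes the pairing with `(1, a)`, and the value `ξ +
a η` is `log z₊ + a log w₊`. -/
theorem dualNorm_one_left {d a : ℝ} (hd : 1 < d) (ha : a ∈ Icc (0 : ℝ) 1) :
    dualNorm d !₂[1, a] = -S d a (wPlus d a) := by
  obtain ⟨ξ, η, hξ, hη, h, hs, hw⟩ := exists_tangent hd ha
  rw [hw, S_exp hξ.le h, neg_neg]
  have hp := Real.sinh_pos_iff.2 hξ
  have e : (!₂[1, a] : Plane) = (Real.sinh ξ)⁻¹ • !₂[Real.sinh ξ, Real.sinh η] := by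
    ext i
    fin_cases i
    · simp
      field_simp
    · simp [hs]
      field_simp
  rw [e, dualNorm_smul hd (inv_pos.2 hp).le, dualNorm_gradient hd h, hs]
  field_simp

/-- Along the curve, the logarithmic derivative of `z₊` at `w = exp η` is `-(sinh η / sinh ξ) / w`.
The normal condition makes this `-a / w`, which cancels the derivative of `a log w`. Positivity of
`sinh ξ` keeps the square root differentiable. -/
theorem hasDerivAt_S_wPlus {d a : ℝ} (hd : 1 < d) (ha : a ∈ Icc (0 : ℝ) 1) :
    HasDerivAt (S d a) 0 (wPlus d a) := by
  obtain ⟨ξ, η, hξ, hη, h, hs, hw⟩ := exists_tangent hd ha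
  have hp := Real.sinh_pos_iff.2 hξ
  have hz := zPlus_exp hξ.le h
  rw [hw]
  have hw0 := (Real.exp_pos η)
  set w := Real.exp η with hwdef
  have e : 4 * d - w - 1 / w = 2 * Real.cosh ξ := by
    rw [one_div, hwdef, ← Real.exp_neg]
    rw [Real.cosh_eq η] at h
    linarith
  have esq : (4 * d - w - 1 / w) ^ 2 - 4 = (2 * Real.sinh ξ) ^ 2 := by
    rw [e]
    have := Real.cosh_sq ξ
    linear_combination 4 * this
  have hB : HasDerivAt (fun w : ℝ => 4 * d - w - 1 / w) (-1 + 1 / w ^ 2) w := by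
    have h1 := ((hasDerivAt_const w (4 * d)).sub (hasDerivAt_id w)).sub (hasDerivAt_inv hw0.ne')
    have h2 : (fun w : ℝ => 4 * d - w - 1 / w) = ((fun _ => 4 * d) - id) - Inv.inv := by
      ext u
      simp
    rw [h2]
    refine h1.congr_deriv ?_
    rw [one_div]
    ring
  have hzd : HasDerivAt (zPlus d) (((-1 + 1 / w ^ 2)
      + (2 * (4 * d - w - 1 / w) * (-1 + 1 / w ^ 2)) / (2 * √((4 * d - w - 1 / w) ^ 2 - 4))) / 2)
      w := by
    have h1 := (((hB.pow 2).sub_const 4).sqrt (by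
      simp only [Pi.pow_apply]
      rw [esq]; positivity))
    refine ((hB.add h1).div_const 2).congr_deriv ?_
    simp
  have hS := ((hzd.log (by rw [hz]; exact (Real.exp_pos ξ).ne')).neg).sub
    ((Real.hasDerivAt_log hw0.ne').const_mul a)
  refine hS.congr_deriv ?_
  rw [hz, esq, Real.sqrt_sq (by linarith), e]
  have e2 : -1 + 1 / w ^ 2 = -2 * Real.sinh η / w := by
    rw [hwdef, Real.sinh_eq, Real.exp_neg]
    field_simp
    ring
  rw [e2, hs, ← Real.cosh_add_sinh ξ]
  have hE : Real.cosh ξ + Real.sinh ξ ≠ 0 := by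
    rw [Real.cosh_add_sinh]
    exact (Real.exp_pos ξ).ne'
  field_simp
  ring

/-! ### The limit curve as a unit sphere -/

/-- Every direction is an outer normal: in this octant the slope `b / a` is the parameter of
`exists_tangent`, and symmetry handles the other octants in `exists_normal`. -/
theorem exists_normal_of_le {d a b : ℝ} (hd : 1 < d) (hb : 0 ≤ b) (hba : b ≤ a) (ha : 0 < a) :
    ∃ ξ η t : ℝ, 0 < ξ ∧ 0 ≤ η ∧ Real.cosh ξ + Real.cosh η = 2 * d ∧ 0 < t ∧
      a = t * Real.sinh ξ ∧ b = t * Real.sinh η := by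
  obtain ⟨ξ, η, hξ, hη, h, hs, -⟩ := exists_tangent hd (a := b / a)
    ⟨div_nonneg hb ha.le, (div_le_one ha).2 hba⟩
  have hp := Real.sinh_pos_iff.2 hξ
  refine ⟨ξ, η, a / Real.sinh ξ, hξ, hη, h, div_pos ha hp, ?_, ?_⟩
  · field_simp
  · rw [hs]
    field_simp

theorem exists_normal {d : ℝ} (hd : 1 < d) (a b : ℝ) (hab : a ≠ 0 ∨ b ≠ 0) :
    ∃ ξ η t : ℝ, Real.cosh ξ + Real.cosh η = 2 * d ∧ 0 < t ∧
      a = t * Real.sinh ξ ∧ b = t * Real.sinh η := by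
  have habs : ∃ ξ η t : ℝ, Real.cosh ξ + Real.cosh η = 2 * d ∧ 0 < t ∧
      |a| = t * Real.sinh ξ ∧ |b| = t * Real.sinh η := by
    rcases le_total |b| |a| with h | h
    · have ha : 0 < |a| := by
        rcases hab with h' | h'
        · exact abs_pos.2 h'
        · exact (abs_pos.2 h').trans_le h
      obtain ⟨ξ, η, t, -, -, h1, h2, h3, h4⟩ := exists_normal_of_le hd (abs_nonneg b) h ha
      exact ⟨ξ, η, t, h1, h2, h3, h4⟩
    · have hb : 0 < |b| := by
        rcases hab with h' | h'
        · exact (abs_pos.2 h').trans_le h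
        · exact abs_pos.2 h'
      obtain ⟨ξ, η, t, -, -, h1, h2, h3, h4⟩ := exists_normal_of_le hd (abs_nonneg a) h hb
      exact ⟨η, ξ, t, by linarith, h2, h4, h3⟩
  obtain ⟨ξ, η, t, h1, h2, h3, h4⟩ := habs
  have hsgn : ∀ c ζ : ℝ, |c| = t * Real.sinh ζ →
      ∃ ζ', Real.cosh ζ' = Real.cosh ζ ∧ c = t * Real.sinh ζ' := by
    intro c ζ hc
    rcases abs_choice c with h | h
    · exact ⟨ζ, rfl, by rw [← h, hc]⟩
    · exact ⟨-ζ, Real.cosh_neg ζ, by rw [Real.sinh_neg, mul_neg, ← hc, h, neg_neg]⟩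
  obtain ⟨ξ', e1, e2⟩ := hsgn a ξ h3
  obtain ⟨η', e3, e4⟩ := hsgn b η h4
  exact ⟨ξ', η', t, by rw [e1, e3, h1], h2, e2, e4⟩

theorem dualNorm_zero {d : ℝ} (hd : 1 < d) : dualNorm d 0 = 0 := by
  have := dualNorm_smul hd le_rfl 0
  simpa using this

theorem eq_toLp (x : Plane) : x = !₂[x 0, x 1] := by
  ext i
  fin_cases i <;> rfl

/-- Every nonzero vector is a positive multiple of a gradient, and by homogeneity the multiple of
unit dual norm is the gradient over its pairing, as in `mem_dualCurve_level_iff`. -/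
theorem limitCurve_eq_sphere {d : ℝ} (hd : 1 < d) : limitCurve d = {q | dualNorm d q = 1} := by
  rw [limitCurve, frontier_gaseousPhase hd]
  ext q
  rw [mem_dualCurve_level_iff hd, mem_ofPred_eq]
  constructor
  · rintro ⟨x, y, h, rfl⟩
    have hD := pairing_pos hd h
    rw [dualNorm_smul hd (inv_pos.2 hD).le, dualNorm_gradient hd h, inv_mul_cancel₀ hD.ne']
  · intro hq
    have hne : q 0 ≠ 0 ∨ q 1 ≠ 0 := by
      by_contra! h
      have : q = 0 := by rw [eq_toLp q, h.1, h.2]; ext i; fin_cases i <;> rfl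
      rw [this, dualNorm_zero hd] at hq
      norm_num at hq
    obtain ⟨x, y, t, h, ht, h0, h1⟩ := exists_normal hd _ _ hne
    have hqe : q = t • !₂[Real.sinh x, Real.sinh y] := by
      rw [eq_toLp q, h0, h1]
      ext i
      fin_cases i <;> simp
    refine ⟨x, y, h, ?_⟩
    rw [hqe, dualNorm_smul hd ht.le, dualNorm_gradient hd h] at hq
    rw [hqe, eq_inv_of_mul_eq_one_left hq]

theorem explicitCurve_eq_sphere {d : ℝ} (hd : 1 < d) :
    explicitCurve d = {q | dualNorm d q = 1} := by
  have hpos : ∀ a ∈ Icc (0 : ℝ) 1, 0 < -S d a (wPlus d a) := by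
    intro a ha
    obtain ⟨ξ, η, hξ, hη, h, hs, hw⟩ := exists_tangent hd ha
    rw [hw, S_exp hξ.le h, neg_neg]
    have := mul_nonneg ha.1 hη
    linarith
  have hunit : ∀ a ∈ Icc (0 : ℝ) 1,
      dualNorm d !₂[-(1 / S d a (wPlus d a)), -(a / S d a (wPlus d a))] = 1 := by
    intro a ha
    have h := hpos a ha
    have e : (!₂[-(1 / S d a (wPlus d a)), -(a / S d a (wPlus d a))] : Plane) =
        (-S d a (wPlus d a))⁻¹ • !₂[1, a] := by
      ext i
      fin_cases i <;> simp [inv_neg, div_eq_mul_inv, mul_comm]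
    rw [e, dualNorm_smul hd (inv_pos.2 h).le, dualNorm_one_left hd ha, inv_mul_cancel₀ h.ne']
  ext q
  constructor
  · rintro ⟨a, ha, ε₁, hε₁, ε₂, hε₂, h⟩
    have h1 := hunit a ha
    rw [mem_ofPred_eq]
    rcases h with rfl | rfl <;> rcases hε₁ with rfl | rfl <;> rcases hε₂ with rfl | rfl <;>
      simp only [one_mul, neg_one_mul, dualNorm_neg_left hd, dualNorm_neg_right hd] at h1 ⊢ <;>
      first | exact h1 | (rw [dualNorm_swap hd]; exact h1)
  · intro (hq : dualNorm d q = 1)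
    have key : ∀ a b : ℝ, |b| ≤ |a| → dualNorm d !₂[a, b] = 1 →
        ∃ c ∈ Icc (0 : ℝ) 1, |a| = -(1 / S d c (wPlus d c)) ∧ |b| = -(c / S d c (wPlus d c)) := by
      intro a b hba h
      have ha : 0 < |a| := by
        rw [abs_pos]
        rintro rfl
        have hb : b = 0 := by simpa using hba
        have h0 := dualNorm_zero hd
        rw [eq_toLp 0] at h0
        rw [hb] at h
        simp only [PiLp.zero_apply] at h0
        linarith
      have hc : |b| / |a| ∈ Icc (0 : ℝ) 1 := ⟨by positivity, (div_le_one ha).2 hba⟩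
      have h2 := dualNorm_one_left hd hc
      have e : (!₂[|a|, |b|] : Plane) = |a| • !₂[1, |b| / |a|] := by
        ext i
        fin_cases i
        · simp
        · simp
          field_simp
      rw [← dualNorm_abs hd, e, dualNorm_smul hd ha.le, h2] at h
      have h3 : |a| = -(1 / S d (|b| / |a|) (wPlus d (|b| / |a|))) := by
        rw [one_div, ← inv_neg]
        exact eq_inv_of_mul_eq_one_left h
      refine ⟨|b| / |a|, hc, h3, ?_⟩
      calc |b| = |b| / |a| * |a| := by field_simp
        _ = _ := by
          nth_rewrite 2 [h3]
          ring
    have hsgn : ∀ c : ℝ, ∃ ε ∈ ({1, -1} : Set ℝ), c = ε * |c| := by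
      intro c
      rcases abs_choice c with h | h
      · exact ⟨1, by simp, by rw [one_mul, h]⟩
      · exact ⟨-1, by simp, by rw [h]; ring⟩
    obtain ⟨ε₁, hε₁, h1⟩ := hsgn (q 0)
    obtain ⟨ε₂, hε₂, h2⟩ := hsgn (q 1)
    rw [eq_toLp q] at hq
    rcases le_total |q 1| |q 0| with hle | hle
    · obtain ⟨c, hc, e1, e2⟩ := key _ _ hle hq
      exact ⟨c, hc, ε₁, hε₁, ε₂, hε₂, Or.inl (by rw [← e1, ← e2, ← h1, ← h2]; exact eq_toLp q)⟩
    · rw [dualNorm_swap hd] at hq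
      obtain ⟨c, hc, e1, e2⟩ := key _ _ hle hq
      exact ⟨c, hc, ε₁, hε₁, ε₂, hε₂, Or.inr (by rw [← e1, ← e2, ← h1, ← h2]; exact eq_toLp q)⟩

theorem limitCurve_eq_explicitCurve {d : ℝ} (hd : 1 < d) : limitCurve d = explicitCurve d := by
  rw [limitCurve_eq_sphere hd, explicitCurve_eq_sphere hd]

/-! ### Weighted one-dimensional walks -/

/-- The total weight of the nearest-neighbour walks of length `k` on `ℤ` from `0` to `s`, where a
step up has weight `a` and a step down has weight `b`. -/
def walkWeight (a b : ℝ) : ℕ → ℤ → ℝ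
  | 0, s => if s = 0 then 1 else 0
  | k + 1, s => a * walkWeight a b k (s - 1) + b * walkWeight a b k (s + 1)

theorem walkWeight_nonneg {a b : ℝ} (ha : 0 ≤ a) (hb : 0 ≤ b) (k : ℕ) :
    ∀ s, 0 ≤ walkWeight a b k s := by
  induction k with
  | zero => intro s; unfold walkWeight; split_ifs <;> norm_num
  | succ k ih => intro s; exact add_nonneg (mul_nonneg ha (ih _)) (mul_nonneg hb (ih _))

theorem walkWeight_eq_zero {a b : ℝ} (k : ℕ) : ∀ s : ℤ, (k : ℤ) < |s| → walkWeight a b k s = 0 := by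
  induction k with
  | zero =>
    intro s hs
    have : s ≠ 0 := by
      rintro rfl
      simp at hs
    simp [walkWeight, this]
  | succ k ih =>
    intro s hs
    push_cast at hs
    rw [walkWeight, ih, ih]
    · ring
    · rw [lt_abs] at hs ⊢
      omega
    · rw [lt_abs] at hs ⊢
      omega

theorem walkWeight_le (k : ℕ) : ∀ s : ℤ, walkWeight 1 1 k s ≤ 2 ^ k := by
  induction k with
  | zero => intro s; unfold walkWeight; split_ifs <;> norm_num
  | succ k ih =>
    intro s
    rw [walkWeight, pow_succ]
    linarith [ih (s - 1), ih (s + 1)]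

theorem walkWeight_neg (k : ℕ) : ∀ s : ℤ, walkWeight 1 1 k (-s) = walkWeight 1 1 k s := by
  induction k with
  | zero => intro s; simp [walkWeight]
  | succ k ih =>
    intro s
    rw [walkWeight, walkWeight, show -s - 1 = -(s + 1) by ring, show -s + 1 = -(s - 1) by ring,
      ih, ih]
    ring

theorem walkWeight_two_mul_sub (a b : ℝ) (k : ℕ) : ∀ j : ℕ, j ≤ k →
    walkWeight a b k (2 * j - k) = k.choose j * a ^ j * b ^ (k - j) := by
  induction k with
  | zero =>
    intro j hj
    obtain rfl : j = 0 := by omega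
    simp [walkWeight]
  | succ k ih =>
    intro j hj
    rw [walkWeight]
    have h2 : walkWeight a b k (2 * (j : ℤ) - ((k + 1 : ℕ) : ℤ) + 1) =
        k.choose j * a ^ j * b ^ (k - j) := by
      -- Here `j` may equal `k + 1`; then the walk weight and the binomial coefficient both vanish.
      rcases Nat.lt_or_ge k j with h | h
      · rw [walkWeight_eq_zero, Nat.choose_eq_zero_of_lt h]
        · simp
        · rw [lt_abs]
          push_cast
          omega
      · rw [← ih j h]
        congr 1
        push_cast
        ring
    rw [h2]
    rcases j with _ | j
    · rw [walkWeight_eq_zero]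
      · simp [pow_succ]
        ring
      · rw [lt_abs]
        push_cast
        omega
    · have h1 : walkWeight a b k (2 * ((j + 1 : ℕ) : ℤ) - ((k + 1 : ℕ) : ℤ) - 1) =
          k.choose j * a ^ j * b ^ (k - j) := by
        rw [← ih j (by omega)]
        congr 1
        push_cast
        ring
      rw [h1, Nat.choose_succ_succ, Nat.add_sub_add_right]
      push_cast
      rcases Nat.lt_or_ge k (j + 1) with h | h
      · rw [Nat.choose_eq_zero_of_lt h]
        push_cast
        ring
      · rw [show k - j = k - (j + 1) + 1 by omega]
        ring

/-- Reweighting steps by `exp (±α)` multiplies each path to `s` by the same factor `exp (α s)`;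
dividing by `2 cosh α` per step makes the weights probabilities. -/
theorem walkWeight_tilt (α : ℝ) (k : ℕ) : ∀ s : ℤ,
    Real.exp (α * s) * walkWeight 1 1 k s = (2 * Real.cosh α) ^ k *
      walkWeight (Real.exp α / (2 * Real.cosh α)) (Real.exp (-α) / (2 * Real.cosh α)) k s := by
  induction k with
  | zero =>
    intro s
    unfold walkWeight
    split_ifs with h <;> simp [h]
  | succ k ih =>
    intro s
    have hc := Real.cosh_pos α
    have h1 := ih (s - 1)
    have h2 := ih (s + 1)
    rw [walkWeight, walkWeight]
    have e1 : Real.exp (α * s) = Real.exp α * Real.exp (α * ((s - 1 : ℤ) : ℝ)) := by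
      rw [← Real.exp_add]
      push_cast
      ring_nf
    have e2 : Real.exp (α * s) = Real.exp (-α) * Real.exp (α * ((s + 1 : ℤ) : ℝ)) := by
      rw [← Real.exp_add]
      push_cast
      ring_nf
    calc Real.exp (α * s) * (1 * walkWeight 1 1 k (s - 1) + 1 * walkWeight 1 1 k (s + 1))
        = Real.exp α * (Real.exp (α * ((s - 1 : ℤ) : ℝ)) * walkWeight 1 1 k (s - 1))
          + Real.exp (-α) * (Real.exp (α * ((s + 1 : ℤ) : ℝ)) * walkWeight 1 1 k (s + 1)) := by
          rw [mul_add, one_mul, one_mul, ← mul_assoc, ← e1, ← mul_assoc, ← e2]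
      _ = _ := by
          rw [h1, h2, pow_succ]
          field_simp

/-- The expected number of visits to `s` of a walk with drift `p - q` is at most `1 / (p - q)`. -/
theorem sum_walkWeight_le {p q : ℝ} (hq : 0 < q) (hqp : q < p) (hpq : p + q = 1) (K : ℕ) :
    ∀ s : ℤ, ∑ k ∈ Finset.range K, walkWeight p q k s ≤
      (if 0 ≤ s then 1 else (q / p) ^ (-s)) / (p - q) := by
  have hp : 0 < p := hq.trans hqp
  have hD : 0 < p - q := sub_pos.2 hqp
  induction K with
  | zero =>
    intro s
    rw [Finset.sum_range_zero]
    split_ifs <;> positivity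
  | succ K ih =>
    intro s
    have hrec : ∑ k ∈ Finset.range (K + 1), walkWeight p q k s = (if s = 0 then 1 else 0)
        + (p * ∑ k ∈ Finset.range K, walkWeight p q k (s - 1)
          + q * ∑ k ∈ Finset.range K, walkWeight p q k (s + 1)) := by
      rw [Finset.sum_range_succ', Finset.mul_sum, Finset.mul_sum, ← Finset.sum_add_distrib]
      simp only [walkWeight]
      ring
    have h1 := mul_le_mul_of_nonneg_left (ih (s - 1)) hp.le
    have h2 := mul_le_mul_of_nonneg_left (ih (s + 1)) hq.le
    rw [hrec]
    -- The bound solves `h s = 1_{s=0} + p h (s-1) + q h (s+1)` exactly, so the induction closes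
    -- with equality; the geometric tail at negative `s` is there for this.
    refine (add_le_add_right (add_le_add h1 h2) _).trans (le_of_eq ?_)
    rcases lt_trichotomy s 0 with h | h | h
    · have hr : q / p ≠ 0 := (div_pos hq hp).ne'
      have e : (if 0 ≤ s + 1 then (1 : ℝ) else (q / p) ^ (-(s + 1))) = (q / p) ^ (-s) * (p / q) := by
        rw [show -s = -(s + 1) + 1 by ring, zpow_add_one₀ hr]
        have : q / p * (p / q) = 1 := by field_simp
        rw [mul_assoc, this, mul_one]
        split_ifs with h'
        · rw [show s + 1 = 0 by omega]
          simp
        · rfl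
      rw [e, if_neg h.ne, if_neg (by omega), if_neg (by omega),
        show -(s - 1) = -s + 1 by ring, zpow_add_one₀ hr]
      generalize (q / p) ^ (-s) = z
      field_simp
      linear_combination z * hpq
    · subst h
      simp
      field_simp
      linear_combination hpq
    · rw [if_neg h.ne', if_pos (by omega), if_pos (by omega), if_pos h.le]
      rw [zero_add, ← add_mul, hpq, one_mul]

/-! ### Two-sided local bounds for binomial probabilities -/

theorem binomial_sum_eq_one {p q : ℝ} (hpq : p + q = 1) (k : ℕ) :
    ∑ j ∈ Finset.range (k + 1), (k.choose j * p ^ j * q ^ (k - j) : ℝ) = 1 := by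
  rw [← one_pow (M := ℝ) k, ← hpq, add_pow]
  exact Finset.sum_congr rfl fun j _ => by ring

/-- Below the mean the probabilities increase, and for about `√k p q / 4` indices past it they
decrease slowly. So at least that many consecutive values starting at `j` are at least half the
value at `j`; their sum is at most 1. -/
theorem binomial_le_of_le_mean {p q : ℝ} (hp : 0 < p) (hq : 0 < q) (hpq : p + q = 1) {k j : ℕ}
    (hk : 0 < k) (hj : (j : ℝ) ≤ k * p) :
    (k.choose j * p ^ j * q ^ (k - j) : ℝ) * (√k * (p * q)) ≤ 8 := by
  set B : ℕ → ℝ := fun i => k.choose i * p ^ i * q ^ (k - i) with hB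
  have hB0 : ∀ i, 0 ≤ B i := fun i => by positivity
  have hkr : (1 : ℝ) ≤ k := by exact_mod_cast hk
  have hsq : √(k : ℝ) ^ 2 = k := Real.sq_sqrt (by positivity)
  have hs1 : 1 ≤ √(k : ℝ) := Real.one_le_sqrt.2 hkr
  have hpq4 : p * q ≤ 1 / 4 := by nlinarith [sq_nonneg (p - q)]
  have hpq0 : 0 < p * q := mul_pos hp hq
  set X := √(k : ℝ) * (p * q) with hX
  have hX0 : 0 < X := by positivity
  set L := ⌊X / 4⌋₊ with hL
  have hL1 : (L : ℝ) ≤ X / 4 := Nat.floor_le (by positivity)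
  have hL2 : X / 4 < L + 1 := Nat.lt_floor_add_one _
  have hlt : ∀ i : ℕ, (i : ℝ) ≤ k * p + L → i < k := by
    intro i hi
    have h1 : (L : ℝ) < k * q := by
      have : X / 4 ≤ k * (p * q) / 4 := by
        rw [hX]
        have : √(k : ℝ) ≤ k := by nlinarith
        have := mul_le_mul_of_nonneg_right this hpq0.le
        linarith
      have h3 : k * (p * q) ≤ k * q := by nlinarith [mul_pos (by linarith : (0 : ℝ) < k) hq]
      nlinarith [mul_pos (by linarith : (0 : ℝ) < k) hq]
    have : (i : ℝ) < k := by
      have : (k : ℝ) = k * p + k * q := by rw [← mul_add, hpq, mul_one]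
      linarith
    exact_mod_cast this
  have hjk : j < k := hlt j (by linarith [(Nat.cast_nonneg L : (0 : ℝ) ≤ L)])
  have hjL : j + L < k := hlt _ (by push_cast; linarith)
  have hsum : ∀ L' : ℕ, j + L' < k → ∑ m ∈ Finset.range (L' + 1), B (j + m) ≤ 1 := by
    intro L' h
    rw [← binomial_sum_eq_one hpq k]
    have e := Finset.sum_Ico_eq_sum_range B j (j + (L' + 1))
    rw [add_tsub_cancel_left] at e
    rw [← e]
    refine Finset.sum_le_sum_of_subset_of_nonneg ?_ fun i _ _ => hB0 i
    intro i hi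
    rw [Finset.mem_Ico] at hi
    rw [Finset.mem_range]
    omega
  change B j * X ≤ 8
  rcases Nat.eq_zero_or_pos L with h0 | hLpos
  · have h1 := hsum 0 (by simpa using hjk)
    simp at h1
    rw [h0] at hL2
    simp at hL2
    have := mul_le_mul h1 (show X ≤ 4 by linarith) hX0.le zero_le_one
    linarith
  have hL3 : (1 : ℝ) ≤ L := by exact_mod_cast hLpos
  -- `δ` bounds the relative loss in one step when the index exceeds the mean by at most `L`; `L ≤
  -- √k p q / 4` keeps the total loss `L δ` at most `1/2`.
  set δ := ((L : ℝ) + 1) / (k * (p * q)) with hδ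
  have hδ0 : 0 ≤ δ := by positivity
  have hratio : ∀ i : ℕ, (i : ℝ) ≤ k * p + L → (1 - δ) * B i ≤ B (i + 1) := by
    intro i hi
    have hik := hlt i hi
    have hrec : ((i : ℝ) + 1) * q * B (i + 1) = (k - i) * p * B i := by
      have h1 : (k.choose (i + 1) : ℝ) * (i + 1) = k.choose i * (k - i) := by
        have := Nat.choose_succ_right_eq k i
        have h2 : ((k - i : ℕ) : ℝ) = (k : ℝ) - i := Nat.cast_sub hik.le
        rw [← h2]
        exact_mod_cast this
      simp only [hB]
      rw [show k - i = k - (i + 1) + 1 by omega, pow_succ p, pow_succ q]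
      linear_combination (p ^ i * p * (q ^ (k - (i + 1)) * q)) * h1
    have hcoef : (1 - δ) * (((i : ℝ) + 1) * q) ≤ (k - i) * p := by
      have e : (k - i) * p - (1 - δ) * (((i : ℝ) + 1) * q) =
          k * p - i - q + δ * ((i + 1) * q) := by
        linear_combination (-(i : ℝ)) * hpq
      have h0 : 0 ≤ δ * (((i : ℝ) + 1) * q) := by positivity
      rcases le_total ((i : ℝ) + 1) (k * p) with h | h
      · nlinarith
      · have h1 : δ * (k * (p * q)) = L + 1 := by
          rw [hδ]
          field_simp
        have h2 : δ * (k * (p * q)) ≤ δ * (((i : ℝ) + 1) * q) := by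
          refine mul_le_mul_of_nonneg_left ?_ hδ0
          nlinarith
        linarith
    have hpos : 0 < ((i : ℝ) + 1) * q := by positivity
    refine le_of_mul_le_mul_left ?_ hpos
    rw [hrec]
    nlinarith [mul_le_mul_of_nonneg_right hcoef (hB0 i)]
  have hδL : (L : ℝ) * δ ≤ 1 / 2 := by
    rw [hδ, ← mul_div_assoc, div_le_iff₀ (by positivity)]
    have h1 : (L : ℝ) * (L + 1) ≤ 2 * (X / 4) ^ 2 := by nlinarith
    have h2 : X ^ 2 = k * (p * q) ^ 2 := by rw [hX, mul_pow, hsq]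
    have h3 : (k : ℝ) * (p * q) ^ 2 ≤ k * (p * q) := by
      have : (p * q) ^ 2 ≤ p * q := by nlinarith
      exact mul_le_mul_of_nonneg_left this (by positivity)
    nlinarith
  clear_value B δ L
  have hind : ∀ m : ℕ, m ≤ L → (1 - m * δ) * B j ≤ B (j + m) := by
    intro m
    induction m with
    | zero => intro _; simp
    | succ m ih =>
      intro hm
      have hmL : (m : ℝ) ≤ L := by exact_mod_cast (by omega : m ≤ L)
      have h1 := hratio (j + m) (by push_cast; linarith)
      have h2 := ih (by omega)
      have hδ1 : 0 ≤ 1 - δ := by nlinarith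
      have h3 := mul_le_mul_of_nonneg_left h2 hδ1
      have h4 : 0 ≤ m * δ * δ * B j := mul_nonneg (by positivity) (hB0 j)
      have h5 : (1 - ((m : ℝ) + 1) * δ) * B j = (1 - δ) * ((1 - m * δ) * B j) - m * δ * δ * B j := by
        ring
      rw [← add_assoc]
      push_cast
      rw [h5]
      linarith
  have hhalf : ∀ m ∈ Finset.range (L + 1), B j / 2 ≤ B (j + m) := by
    intro m hm
    have hm' : m ≤ L := by simpa [Nat.lt_succ_iff] using hm
    have h1 := hind m hm'
    have hmL : (m : ℝ) ≤ L := by exact_mod_cast hm'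
    have h2 : (m : ℝ) * δ ≤ 1 / 2 := (mul_le_mul_of_nonneg_right hmL hδ0).trans hδL
    have h3 : 1 / 2 * B j ≤ (1 - m * δ) * B j :=
      mul_le_mul_of_nonneg_right (by linarith) (hB0 j)
    linarith
  have := (Finset.card_nsmul_le_sum _ _ _ hhalf).trans (hsum L hjL)
  rw [Finset.card_range, nsmul_eq_mul] at this
  push_cast at this
  have h1 := mul_le_mul_of_nonneg_left hL2.le (hB0 j)
  linarith

theorem binomial_le {p q : ℝ} (hp : 0 < p) (hq : 0 < q) (hpq : p + q = 1) {k j : ℕ}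
    (hk : 0 < k) (hj : j ≤ k) :
    (k.choose j * p ^ j * q ^ (k - j) : ℝ) * (√k * (p * q)) ≤ 8 := by
  rcases le_total (j : ℝ) (k * p) with h | h
  · exact binomial_le_of_le_mean hp hq hpq hk h
  · have h1 := binomial_le_of_le_mean hq hp (by linarith) hk (j := k - j) (by
      rw [Nat.cast_sub hj]
      have : (k : ℝ) = k * p + k * q := by rw [← mul_add, hpq, mul_one]
      linarith)
    rw [Nat.choose_symm hj, Nat.sub_sub_self hj] at h1
    calc _ = (k.choose j * q ^ (k - j) * p ^ j : ℝ) * (√k * (q * p)) := by ring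
      _ ≤ 8 := h1

theorem walkWeight_le_div_sqrt {p q : ℝ} (hp : 0 < p) (hq : 0 < q) (hpq : p + q = 1) {k : ℕ}
    (hk : 0 < k) (s : ℤ) (hs : (s - k) % 2 = 0) :
    walkWeight p q k s * (√k * (p * q)) ≤ 8 := by
  rcases lt_or_ge (k : ℤ) |s| with h | h
  · rw [walkWeight_eq_zero k s h]
    norm_num
  · rw [abs_le] at h
    obtain ⟨j, hj⟩ : ∃ j : ℕ, s = 2 * j - k := ⟨((s + k) / 2).toNat, by omega⟩
    rw [hj, walkWeight_two_mul_sub p q k j (by omega)]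
    exact binomial_le hp hq hpq hk (by omega)

/-- The Stirling ratio decreases from its first value `e / √2`, which fixes the constant. -/
theorem factorial_le_stirling {n : ℕ} (hn : 0 < n) :
    (n.factorial : ℝ) ≤ Real.exp 1 * √n * (n / Real.exp 1) ^ n := by
  obtain ⟨m, rfl⟩ := Nat.exists_eq_succ_of_ne_zero hn.ne'
  have h1 : Stirling.stirlingSeq (m + 1) ≤ Stirling.stirlingSeq 1 :=
    Stirling.stirlingSeq'_antitone (Nat.zero_le m)
  rw [Stirling.stirlingSeq_one, Stirling.stirlingSeq, div_le_iff₀ (by positivity)] at h1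
  refine h1.trans (le_of_eq ?_)
  rw [Real.sqrt_mul (by norm_num)]
  field_simp

theorem stirling_le_factorial (n : ℕ) :
    √n * (n / Real.exp 1) ^ n ≤ (n.factorial : ℝ) := by
  refine le_trans ?_ (Stirling.le_factorial_stirling n)
  refine mul_le_mul_of_nonneg_right (Real.sqrt_le_sqrt ?_) (by positivity)
  have : (1 : ℝ) ≤ 2 * Real.pi := by linarith [Real.pi_gt_three]
  exact le_mul_of_one_le_left (by positivity) this

/-- This is `t ≤ exp (t - 1)` at `t = j / a`, raised to the power `j`; it yields the Gaussian factor
in `le_binomial`. -/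
theorem exp_le_div_pow {a : ℝ} (ha : 0 < a) {j : ℕ} (hj : 0 < j) :
    Real.exp (j - j ^ 2 / a) ≤ (a / j) ^ j := by
  have hj' : (0 : ℝ) < j := by exact_mod_cast hj
  have h1 : Real.exp (1 - j / a) ≤ a / j := by
    have := Real.add_one_le_exp (j / a - 1)
    rw [sub_add_cancel] at this
    rw [show 1 - j / a = -(j / a - 1) by ring, Real.exp_neg,
      inv_le_comm₀ (Real.exp_pos _) (by positivity), inv_div]
    exact this
  calc Real.exp (j - j ^ 2 / a) = Real.exp (1 - j / a) ^ j := by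
        rw [← Real.exp_nat_mul]
        congr 1
        ring
    _ ≤ _ := pow_le_pow_left₀ (Real.exp_pos _).le h1 j

theorem le_binomial {p q : ℝ} (hp : 0 < p) (hq : 0 < q) (hpq : p + q = 1) {k j : ℕ}
    (hj : 0 < j) (hjk : j < k) :
    Real.exp (-2) / √k * Real.exp (-((j - k * p) ^ 2 / (k * (p * q)))) ≤
      (k.choose j * p ^ j * q ^ (k - j) : ℝ) := by
  obtain ⟨l, rfl⟩ : ∃ l, k = j + l := ⟨k - j, by omega⟩
  have hl : 0 < l := by omega
  have hj' : (0 : ℝ) < j := by exact_mod_cast hj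
  have hl' : (0 : ℝ) < l := by exact_mod_cast hl
  rw [Nat.add_sub_cancel_left]
  set k : ℝ := ((j + l : ℕ) : ℝ) with hk
  have hkjl : k = j + l := by rw [hk]; push_cast; ring
  have hk0 : 0 < k := by rw [hkjl]; positivity
  have hch : ((j + l).choose j : ℝ) = (j + l).factorial / (j.factorial * l.factorial) := by
    rw [eq_div_iff (by positivity), ← mul_assoc]
    have := Nat.add_choose_mul_factorial_mul_factorial l j
    rw [add_comm l j, Nat.choose_symm_add] at this
    calc ((j + l).choose j : ℝ) * j.factorial * l.factorial
        = (((j + l).choose j * l.factorial * j.factorial : ℕ) : ℝ) := by push_cast; ring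
      _ = _ := by
        rw [← this, ← Nat.choose_symm_add]
  have hE := Real.exp_pos 1
  have h1 := exp_le_div_pow (a := k * p) (by positivity) hj
  have h2 := exp_le_div_pow (a := k * q) (by positivity) hl
  have hsq : √(j : ℝ) * √(l : ℝ) ≤ k := by
    rw [← Real.sqrt_mul hj'.le]
    refine Real.sqrt_le_iff.2 ⟨hk0.le, ?_⟩
    rw [hkjl]
    nlinarith
  -- With `j + l = k` and `p + q = 1`, the two exponents from `exp_le_div_pow` add up exactly to the
  -- Gaussian exponent.
  have hexp : Real.exp (-((j - k * p) ^ 2 / (k * (p * q)))) =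
      Real.exp (j - j ^ 2 / (k * p)) * Real.exp (l - l ^ 2 / (k * q)) := by
    rw [← Real.exp_add]
    congr 1
    have hl2 : (l : ℝ) = k - j := by linarith
    have hq2 : q = 1 - p := by linarith
    rw [hl2]
    field_simp
    rw [hq2]
    ring
  have hsk : √k * √k = k := Real.mul_self_sqrt hk0.le
  have hsk0 : 0 < √k := Real.sqrt_pos.2 hk0
  calc Real.exp (-2) / √k * Real.exp (-((j - k * p) ^ 2 / (k * (p * q))))
      ≤ Real.exp (-2) / √k * ((k * p / j) ^ j * (k * q / l) ^ l) := by
        rw [hexp]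
        gcongr
    _ ≤ Real.exp (-2) * (√k / (√j * √l)) * ((k * p / j) ^ j * (k * q / l) ^ l) := by
        have : Real.exp (-2) / √k ≤ Real.exp (-2) * (√k / (√j * √l)) := by
          rw [div_eq_mul_inv]
          refine mul_le_mul_of_nonneg_left ?_ (Real.exp_pos _).le
          rw [inv_eq_one_div, div_le_div_iff₀ hsk0 (by positivity), one_mul, hsk]
          exact hsq
        exact mul_le_mul_of_nonneg_right this (by positivity)
    _ = √k * (k / Real.exp 1) ^ (j + l) /
          ((Real.exp 1 * √j * (j / Real.exp 1) ^ j) * (Real.exp 1 * √l * (l / Real.exp 1) ^ l))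
          * p ^ j * q ^ l := by
        rw [show (-2 : ℝ) = -1 + -1 by norm_num, Real.exp_add, Real.exp_neg]
        simp only [div_pow, mul_pow, pow_add]
        field_simp
    _ ≤ (j + l).factorial / (j.factorial * l.factorial) * p ^ j * q ^ l := by
        have h3 := stirling_le_factorial (j + l)
        have h4 := factorial_le_stirling hj
        have h5 := factorial_le_stirling hl
        gcongr
    _ = _ := by rw [hch]

/-! ### The Green function of the leaky sandpile -/

/-- The Green function of `4 d - (sum over the four nearest neighbours)`, as the generating function
of lattice walks. In the coordinates `x + y`, `x - y` a walk on `ℤ²` is a pair of independent walks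
on `ℤ`. -/
def green (d : ℝ) (x : Site) : ℝ :=
  ∑' k : ℕ, walkWeight 1 1 k (x.1 + x.2) * walkWeight 1 1 k (x.1 - x.2) / (4 * d) ^ (k + 1)

theorem greenTerm_nonneg {d : ℝ} (hd : 1 < d) (s t : ℤ) (k : ℕ) :
    0 ≤ walkWeight 1 1 k s * walkWeight 1 1 k t / (4 * d) ^ (k + 1) :=
  div_nonneg (mul_nonneg (walkWeight_nonneg zero_le_one zero_le_one k s)
    (walkWeight_nonneg zero_le_one zero_le_one k t)) (by positivity)

theorem greenTerm_le {d : ℝ} (hd : 1 < d) (s t : ℤ) (k : ℕ) :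
    walkWeight 1 1 k s * walkWeight 1 1 k t / (4 * d) ^ (k + 1) ≤ d⁻¹ ^ k := by
  have h0 : (0 : ℝ) < d := by linarith
  rw [div_le_iff₀ (by positivity)]
  calc walkWeight 1 1 k s * walkWeight 1 1 k t ≤ 2 ^ k * 2 ^ k :=
        mul_le_mul (walkWeight_le k s) (walkWeight_le k t)
          (walkWeight_nonneg zero_le_one zero_le_one k t) (by positivity)
    _ = d⁻¹ ^ k * (4 * d) ^ k := by
        rw [← mul_pow, ← mul_pow]
        congr 1
        field_simp
        norm_num
    _ ≤ d⁻¹ ^ k * (4 * d) ^ (k + 1) := by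
        refine mul_le_mul_of_nonneg_left ?_ (by positivity)
        exact pow_le_pow_right₀ (by linarith) (Nat.le_succ k)

theorem summable_geometric_inv {d : ℝ} (hd : 1 < d) : Summable fun k : ℕ => d⁻¹ ^ k :=
  summable_geometric_of_lt_one (by positivity) (inv_lt_one_of_one_lt₀ hd)

theorem summable_greenTerm {d : ℝ} (hd : 1 < d) (s t : ℤ) :
    Summable fun k : ℕ => walkWeight 1 1 k s * walkWeight 1 1 k t / (4 * d) ^ (k + 1) :=
  Summable.of_nonneg_of_le (greenTerm_nonneg hd s t) (greenTerm_le hd s t)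
    (summable_geometric_inv hd)

theorem green_nonneg {d : ℝ} (hd : 1 < d) (x : Site) : 0 ≤ green d x :=
  tsum_nonneg (greenTerm_nonneg hd _ _)

theorem green_le {d : ℝ} (hd : 1 < d) (x : Site) : green d x ≤ ∑' k : ℕ, d⁻¹ ^ k :=
  (summable_greenTerm hd _ _).tsum_le_tsum (greenTerm_le hd _ _) (summable_geometric_inv hd)

theorem green_equation {d : ℝ} (hd : 1 < d) (x : Site) :
    4 * d * green d x = (if x = (0, 0) then 1 else 0) + green d (x.1 - 1, x.2)
      + green d (x.1 + 1, x.2) + green d (x.1, x.2 - 1) + green d (x.1, x.2 + 1) := by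
  obtain ⟨x, y⟩ := x
  have h0 : (4 * d) ≠ 0 := by positivity
  have hs := summable_greenTerm hd
  have e0 : green d (x, y) = walkWeight 1 1 0 (x + y) * walkWeight 1 1 0 (x - y) / (4 * d) +
      ∑' k : ℕ, walkWeight 1 1 (k + 1) (x + y) * walkWeight 1 1 (k + 1) (x - y)
        / (4 * d) ^ (k + 1 + 1) := by
    rw [green, (hs _ _).tsum_eq_zero_add]
    simp
  -- A lattice step changes each of `x + y`, `x - y` by `±1`, so the product of the two recurrences
  -- has one term per neighbour.
  have e1 : ∀ k : ℕ, walkWeight 1 1 (k + 1) (x + y) * walkWeight 1 1 (k + 1) (x - y)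
        / (4 * d) ^ (k + 1 + 1) =
      (walkWeight 1 1 k (x - 1 + y) * walkWeight 1 1 k (x - 1 - y) / (4 * d) ^ (k + 1)
      + walkWeight 1 1 k (x + 1 + y) * walkWeight 1 1 k (x + 1 - y) / (4 * d) ^ (k + 1)
      + walkWeight 1 1 k (x + (y - 1)) * walkWeight 1 1 k (x - (y - 1)) / (4 * d) ^ (k + 1)
      + walkWeight 1 1 k (x + (y + 1)) * walkWeight 1 1 k (x - (y + 1)) / (4 * d) ^ (k + 1))
        / (4 * d) := by
    intro k
    rw [walkWeight, walkWeight, show x - 1 + y = x + y - 1 by ring,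
      show x - 1 - y = x - y - 1 by ring, show x + 1 + y = x + y + 1 by ring,
      show x + 1 - y = x - y + 1 by ring, show x + (y - 1) = x + y - 1 by ring,
      show x - (y - 1) = x - y + 1 by ring, show x + (y + 1) = x + y + 1 by ring,
      show x - (y + 1) = x - y - 1 by ring, pow_succ _ (k + 1)]
    field_simp
    ring
  have e2 : walkWeight 1 1 0 (x + y) * walkWeight 1 1 0 (x - y) =
      if (x, y) = ((0 : ℤ), (0 : ℤ)) then 1 else 0 := by
    simp only [walkWeight, Prod.mk.injEq]
    split_ifs <;> first | omega | norm_num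
  rw [e0, tsum_congr e1, tsum_div_const, Summable.tsum_add (((hs _ _).add (hs _ _)).add (hs _ _))
    (hs _ _), Summable.tsum_add ((hs _ _).add (hs _ _)) (hs _ _),
    Summable.tsum_add (hs _ _) (hs _ _), e2]
  simp only [green]
  field_simp
  ring

theorem green_swap (d : ℝ) (x y : ℤ) : green d (y, x) = green d (x, y) := by
  simp only [green]
  refine tsum_congr fun k => ?_
  rw [add_comm y x, show y - x = -(x - y) by ring, walkWeight_neg]

theorem green_neg_left (d : ℝ) (x y : ℤ) : green d (-x, y) = green d (x, y) := by
  simp only [green]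
  refine tsum_congr fun k => ?_
  rw [show -x + y = -(x - y) by ring, show -x - y = -(x + y) by ring, walkWeight_neg,
    walkWeight_neg]
  ring

theorem green_abs (d : ℝ) (x y : ℤ) : green d (|x|, |y|) = green d (x, y) := by
  have h : ∀ x y : ℤ, green d (|x|, y) = green d (x, y) := by
    intro x y
    rcases abs_choice x with h | h <;> rw [h]
    exact green_neg_left d x y
  rw [h, green_swap, h, green_swap]

/-! ### Tilting the walk -/

/-- The probability of a step up of the walk tilted by `α`. -/
def stepUp (α : ℝ) : ℝ := Real.exp α / (2 * Real.cosh α)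

/-- The probability of a step down of the walk tilted by `α`. -/
def stepDown (α : ℝ) : ℝ := Real.exp (-α) / (2 * Real.cosh α)

theorem stepUp_pos (α : ℝ) : 0 < stepUp α :=
  div_pos (Real.exp_pos _) (mul_pos two_pos (Real.cosh_pos _))

theorem stepDown_pos (α : ℝ) : 0 < stepDown α :=
  div_pos (Real.exp_pos _) (mul_pos two_pos (Real.cosh_pos _))

theorem stepUp_add_stepDown (α : ℝ) : stepUp α + stepDown α = 1 := by
  have := Real.cosh_pos α
  rw [stepUp, stepDown, ← add_div, div_eq_one_iff_eq (by positivity), Real.cosh_eq]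
  ring

theorem stepUp_sub_stepDown (α : ℝ) : stepUp α - stepDown α = Real.tanh α := by
  have := Real.cosh_pos α
  rw [stepUp, stepDown, ← sub_div, Real.tanh_eq_sinh_div_cosh, Real.sinh_eq]
  field_simp

theorem stepUp_mul_stepDown (α : ℝ) : stepUp α * stepDown α = (4 * Real.cosh α ^ 2)⁻¹ := by
  have := Real.cosh_pos α
  rw [stepUp, stepDown, div_mul_div_comm, ← Real.exp_add, add_neg_cancel, Real.exp_zero,
    one_div]
  congr 1
  ring

/-- The condition on `α`, `β` says `4d = (2 cosh α)(2 cosh β)`, so tilting cancels the leak factor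
at every length `k` simultaneously. -/
theorem greenTerm_eq {d α β : ℝ} (hd : 1 < d) (h : Real.cosh α * Real.cosh β = d) (s t : ℤ)
    (k : ℕ) :
    walkWeight 1 1 k s * walkWeight 1 1 k t / (4 * d) ^ (k + 1) =
      Real.exp (-(α * s + β * t)) / (4 * d) * (walkWeight (stepUp α) (stepDown α) k s *
        walkWeight (stepUp β) (stepDown β) k t) := by
  have h1 := walkWeight_tilt α k s
  have h2 := walkWeight_tilt β k t
  change _ = _ * walkWeight (stepUp α) (stepDown α) k s at h1
  change _ = _ * walkWeight (stepUp β) (stepDown β) k t at h2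
  have h3 : (4 * d) ^ k = (2 * Real.cosh α) ^ k * (2 * Real.cosh β) ^ k := by
    rw [← mul_pow, ← h]
    ring
  have hd0 : 0 < d := by linarith
  rw [pow_succ, div_eq_iff (by positivity)]
  calc walkWeight 1 1 k s * walkWeight 1 1 k t
      = Real.exp (-(α * s + β * t)) * ((Real.exp (α * s) * walkWeight 1 1 k s) *
          (Real.exp (β * t) * walkWeight 1 1 k t)) := by
        rw [neg_add, Real.exp_add, Real.exp_neg, Real.exp_neg]
        field_simp
    _ = _ := by
        rw [h1, h2, h3]
        field_simp

/-- From `tanh α ≥ tanh² α = 1 - 1 / cosh² α`; it bounds the drift of the first tilted walk below,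
uniformly over directions. -/
theorem tanh_lower_bound {d α : ℝ} (hd : 1 < d) (hα : 0 ≤ α) (h : d ≤ Real.cosh α ^ 2) :
    1 - 1 / d ≤ Real.tanh α := by
  have hc := Real.cosh_pos α
  have hs := Real.sinh_nonneg_iff.2 hα
  have hsc : Real.sinh α ≤ Real.cosh α := (Real.sinh_lt_cosh α).le
  have hsq := Real.cosh_sq α
  have h1 : 1 / Real.cosh α ^ 2 ≤ 1 / d := one_div_le_one_div_of_le (by linarith) h
  have h2 : 1 - 1 / Real.cosh α ^ 2 ≤ Real.tanh α := by
    rw [Real.tanh_eq_sinh_div_cosh, ← sub_nonneg]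
    have : Real.sinh α / Real.cosh α - (1 - 1 / Real.cosh α ^ 2) =
        Real.sinh α * (Real.cosh α - Real.sinh α) / Real.cosh α ^ 2 := by
      field_simp
      linear_combination -hsq
    rw [this]
    exact div_nonneg (mul_nonneg hs (sub_nonneg.2 hsc)) (by positivity)
  linarith

theorem tanh_lt_one (α : ℝ) : Real.tanh α < 1 := by
  rw [Real.tanh_eq_sinh_div_cosh, div_lt_one (Real.cosh_pos α)]
  exact Real.sinh_lt_cosh α

/-- The first walk cannot reach `s` before time `s`, so in every nonzero term the second factor is
at most a constant over `√s`. What remains is the expected number of visits of a walk with drift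
`tanh α`. -/
theorem sum_walkWeight_mul_le {d α β : ℝ} (hd : 1 < d) (hα : 0 ≤ α)
    (hα2 : d ≤ Real.cosh α ^ 2) (hβ : Real.cosh β ≤ d) {s t : ℤ} (hs : 0 < s)
    (hst : (s - t) % 2 = 0) (K : ℕ) :
    ∑ k ∈ Finset.range K, walkWeight (stepUp α) (stepDown α) k s *
      walkWeight (stepUp β) (stepDown β) k t ≤ 32 * d ^ 2 / (1 - 1 / d) / √s := by
  have hT := tanh_lower_bound hd hα hα2
  have hd1 : 0 < 1 - 1 / d := by
    rw [sub_pos, div_lt_one (by linarith)]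
    exact hd
  have hs' : (0 : ℝ) < s := by exact_mod_cast hs
  have hterm : ∀ k : ℕ, walkWeight (stepUp α) (stepDown α) k s *
      walkWeight (stepUp β) (stepDown β) k t ≤
      walkWeight (stepUp α) (stepDown α) k s * (32 * d ^ 2 / √s) := by
    intro k
    by_cases hks : (k : ℤ) < |s|
    · rw [walkWeight_eq_zero k s hks, zero_mul, zero_mul]
    · rw [abs_of_pos hs] at hks
      have hnn := walkWeight_nonneg (stepUp_pos α).le (stepDown_pos α).le k s
      -- `s` and `t` have the same parity: when `k` shares it the local bound applies to `t`,
      -- otherwise the first factor vanishes.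
      by_cases hpar : (s - k) % 2 = 0
      · refine mul_le_mul_of_nonneg_left ?_ hnn
        have h1 := walkWeight_le_div_sqrt (stepUp_pos β) (stepDown_pos β) (stepUp_add_stepDown β)
          (k := k) (by omega) t (by omega)
        rw [stepUp_mul_stepDown] at h1
        have hw := walkWeight_nonneg (stepUp_pos β).le (stepDown_pos β).le k t
        have hcβ := Real.cosh_pos β
        have h2 : (4 * d ^ 2)⁻¹ ≤ (4 * Real.cosh β ^ 2)⁻¹ := by
          apply inv_anti₀ (by positivity)
          gcongr
        have h3 : √(s : ℝ) ≤ √(k : ℝ) := Real.sqrt_le_sqrt (by exact_mod_cast not_lt.1 hks)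
        rw [le_div_iff₀ (Real.sqrt_pos.2 hs')]
        have h4 : walkWeight (stepUp β) (stepDown β) k t * (√(s : ℝ) * (4 * d ^ 2)⁻¹) ≤ 8 := by
          refine le_trans ?_ h1
          gcongr
        have h5 : walkWeight (stepUp β) (stepDown β) k t * √(s : ℝ) =
            walkWeight (stepUp β) (stepDown β) k t * (√(s : ℝ) * (4 * d ^ 2)⁻¹) * (4 * d ^ 2) := by
          field_simp
        rw [h5]
        nlinarith [sq_nonneg d]
      · have : walkWeight (stepUp α) (stepDown α) k s = 0 := by
          have aux : ∀ k : ℕ, ∀ s : ℤ, (s - k) % 2 ≠ 0 →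
              walkWeight (stepUp α) (stepDown α) k s = 0 := by
            intro k
            induction k with
            | zero =>
              intro s hs
              have : s ≠ 0 := by
                rintro rfl
                simp at hs
              simp [walkWeight, this]
            | succ k ih =>
              intro s hs
              push_cast at hs
              rw [walkWeight, ih _ (by omega), ih _ (by omega)]
              ring
          exact aux k s hpar
        rw [this, zero_mul, zero_mul]
  have hdrift := stepUp_sub_stepDown α
  have hsum := sum_walkWeight_le (stepDown_pos α) (by linarith) (stepUp_add_stepDown α) K s
  rw [if_pos hs.le, hdrift] at hsum
  calc _ ≤ ∑ k ∈ Finset.range K, walkWeight (stepUp α) (stepDown α) k s * (32 * d ^ 2 / √s) :=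
        Finset.sum_le_sum fun k _ => hterm k
    _ = (∑ k ∈ Finset.range K, walkWeight (stepUp α) (stepDown α) k s) * (32 * d ^ 2 / √s) := by
        rw [Finset.sum_mul]
    _ ≤ 1 / (1 - 1 / d) * (32 * d ^ 2 / √s) := by
        refine mul_le_mul_of_nonneg_right (hsum.trans ?_) (by positivity)
        exact one_div_le_one_div_of_le hd1 hT
    _ = _ := by ring

/-- The constant in the local lower bound `le_walkWeight`. -/
def localConst (d : ℝ) : ℝ := Real.exp (-2) * Real.exp (-(4 * d ^ 2))

theorem localConst_pos (d : ℝ) : 0 < localConst d := mul_pos (Real.exp_pos _) (Real.exp_pos _)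

/-- The number of up-steps is within `√k` of its mean, so the exponent in `le_binomial` is at most
`1 / (p q) = 4 cosh² α ≤ 4 d²`. -/
theorem le_walkWeight {d α : ℝ} (hα : Real.cosh α ≤ d) {k j : ℕ} (hj : 0 < j) (hjk : j < k)
    {s : ℤ} (hs : s = 2 * j - k) (h : |(s : ℝ) - k * Real.tanh α| ≤ 2 * √k) :
    localConst d / √k ≤ walkWeight (stepUp α) (stepDown α) k s := by
  have hk : (0 : ℝ) < k := by exact_mod_cast (by omega : 0 < k)
  rw [hs, walkWeight_two_mul_sub _ _ k j hjk.le]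
  refine le_trans ?_ (le_binomial (stepUp_pos α) (stepDown_pos α) (stepUp_add_stepDown α) hj hjk)
  have hc := Real.cosh_pos α
  have hsum := stepUp_add_stepDown α
  have hdiff := stepUp_sub_stepDown α
  have hdev : (j - k * stepUp α) ^ 2 ≤ k := by
    have e : (j - k * stepUp α : ℝ) = (s - k * Real.tanh α) / 2 := by
      rw [hs]
      push_cast
      have : stepUp α = (1 + Real.tanh α) / 2 := by linarith
      rw [this]
      ring
    rw [e, ← sq_abs, abs_div, abs_two]
    have h1 : |(s : ℝ) - k * Real.tanh α| / 2 ≤ √k := by linarith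
    calc _ ≤ √(k : ℝ) ^ 2 := pow_le_pow_left₀ (by positivity) h1 2
      _ = k := Real.sq_sqrt hk.le
  have hexp : (j - k * stepUp α) ^ 2 / (k * (stepUp α * stepDown α)) ≤ 4 * d ^ 2 := by
    rw [stepUp_mul_stepDown, div_le_iff₀ (by positivity)]
    have h1 : Real.cosh α ^ 2 ≤ d ^ 2 := pow_le_pow_left₀ hc.le hα 2
    have h2 : 1 ≤ 4 * d ^ 2 * (4 * Real.cosh α ^ 2)⁻¹ := by
      rw [← div_eq_mul_inv, one_le_div (by positivity)]
      linarith
    nlinarith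
  rw [localConst, mul_div_right_comm]
  gcongr

theorem le_walkWeight_mul {d α β k₀ : ℝ} (hα : Real.cosh α ≤ d) (hβ : Real.cosh β ≤ d)
    {X Y m k : ℕ} (hX : 0 < X) (hm : 0 < m) (hk : k = X + Y + 2 * m) (hk₀ : 1 ≤ k₀)
    (h1 : k₀ ≤ k) (h2 : (k : ℝ) ≤ k₀ + 2 * √k₀)
    (hs : (((X : ℤ) + (Y : ℤ) : ℤ) : ℝ) = k₀ * Real.tanh α)
    (ht : (((X : ℤ) - (Y : ℤ) : ℤ) : ℝ) = k₀ * Real.tanh β) :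
    localConst d ^ 2 / (3 * k₀) ≤ walkWeight (stepUp α) (stepDown α) k ((X : ℤ) + (Y : ℤ)) *
        walkWeight (stepUp β) (stepDown β) k ((X : ℤ) - (Y : ℤ)) := by
  have hk0 : (0 : ℝ) < k := by linarith
  have hsq : √k₀ ≤ √(k : ℝ) := Real.sqrt_le_sqrt h1
  have hsq1 : √k₀ ≤ k₀ := Real.sqrt_le_iff.2 ⟨by linarith, by nlinarith⟩
  have hdev : ∀ γ : ℝ, |k₀ * Real.tanh γ - k * Real.tanh γ| ≤ 2 * √(k : ℝ) := by
    intro γ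
    have hb0 : |Real.tanh γ| ≤ 1 := by
      rw [abs_le]
      have h3 := tanh_lt_one γ
      have h4 := tanh_lt_one (-γ)
      rw [Real.tanh_neg] at h4
      constructor <;> linarith
    rw [← sub_mul, abs_mul, abs_of_nonpos (by linarith)]
    have := mul_le_mul_of_nonneg_left hb0 (show 0 ≤ -(k₀ - k) by linarith)
    linarith
  have hw1 := le_walkWeight hα (k := k) (j := X + Y + m) (by omega)
    (by omega) (s := (X : ℤ) + (Y : ℤ)) (by rw [hk]; push_cast; ring) (by rw [hs]; exact hdev α)
  have hw2 := le_walkWeight hβ (k := k) (j := X + m) (by omega)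
    (by omega) (s := (X : ℤ) - (Y : ℤ)) (by rw [hk]; push_cast; ring) (by rw [ht]; exact hdev β)
  have hc := localConst_pos d
  calc localConst d ^ 2 / (3 * k₀) ≤ localConst d ^ 2 / k :=
        div_le_div_of_nonneg_left (by positivity) hk0 (by linarith)
    _ = localConst d / √(k : ℝ) * (localConst d / √(k : ℝ)) := by
        rw [div_mul_div_comm, Real.mul_self_sqrt hk0.le, sq]
    _ ≤ _ := mul_le_mul hw1 hw2 (by positivity) (le_trans (by positivity) hw1)

/-- By `hdir` both tilted walks have their mean at the target at the same time `k₀ = (x + y) / tanh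
α`. About `√k₀` lengths of the right parity lie within `2√k₀` after `k₀`, and each contributes a
constant times `1 / k₀`. -/
theorem le_tsum_walkWeight_mul {d α β : ℝ} (hd : 1 < d) (hα0 : 0 ≤ α) (hα : Real.cosh α ≤ d)
    (hα2 : d ≤ Real.cosh α ^ 2) (hβ : Real.cosh β ≤ d) {x y : ℤ} (hy : 0 ≤ y) (hyx : y ≤ x)
    (hx : 0 < x) (hdir : ((x - y : ℤ) : ℝ) * Real.tanh α = ((x + y : ℤ) : ℝ) * Real.tanh β)
    (hsum : Summable fun k => walkWeight (stepUp α) (stepDown α) k (x + y) *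
      walkWeight (stepUp β) (stepDown β) k (x - y)) :
    localConst d ^ 2 * √(1 - 1 / d) / 6 / √((x + y : ℤ) : ℝ) ≤
      ∑' k, walkWeight (stepUp α) (stepDown α) k (x + y) *
        walkWeight (stepUp β) (stepDown β) k (x - y) := by
  have hT := tanh_lower_bound hd hα0 hα2
  have hT1 := tanh_lt_one α
  have hd1 : 0 < 1 - 1 / d := by
    rw [sub_pos, div_lt_one (by linarith)]
    exact hd
  obtain ⟨X, rfl⟩ := Int.eq_ofNat_of_zero_le hx.le
  obtain ⟨Y, rfl⟩ := Int.eq_ofNat_of_zero_le hy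
  set T := Real.tanh α with hTdef
  have hT0 : 0 < T := by linarith
  set s : ℝ := (((X : ℤ) + (Y : ℤ) : ℤ) : ℝ) with hs
  have hsXY : s = X + Y := by rw [hs]; push_cast; ring
  have hs1 : 1 ≤ s := by
    rw [hsXY]
    have : (1 : ℝ) ≤ X := by exact_mod_cast hx
    have : (0 : ℝ) ≤ Y := Nat.cast_nonneg Y
    linarith
  set k₀ := s / T with hk₀
  have hk₀T : k₀ * T = s := div_mul_cancel₀ _ hT0.ne'
  have hsk : s < k₀ := by
    rw [hk₀, lt_div_iff₀ hT0]
    nlinarith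
  have hk₀0 : 0 < k₀ := by linarith
  -- `X + Y + 2 m₀` is the first length of the right parity that is at least `k₀`; `m₀ > 0` keeps
  -- both binomial indices strictly inside their range.
  set m₀ := ⌈(k₀ - s) / 2⌉₊ with hm₀
  have hm₀1 : (k₀ - s) / 2 ≤ m₀ := Nat.le_ceil _
  have hm₀2 : (m₀ : ℝ) < (k₀ - s) / 2 + 1 := Nat.ceil_lt_add_one (by linarith)
  have hm₀0 : 0 < m₀ := Nat.ceil_pos.2 (by linarith)
  set M := ⌊√k₀⌋₊ with hM
  have hsq1 : 1 ≤ √k₀ := Real.one_le_sqrt.2 (by linarith)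
  have hsqsq : √k₀ * √k₀ = k₀ := Real.mul_self_sqrt hk₀0.le
  have hM1 : (M : ℝ) ≤ √k₀ := Nat.floor_le (by positivity)
  have hM2 : √k₀ < M + 1 := Nat.lt_floor_add_one _
  have hM0 : 1 ≤ M := Nat.le_floor (by simpa using hsq1)
  let κ : ℕ → ℕ := fun m => X + Y + 2 * (m₀ + m)
  have hκ1 : ∀ m, k₀ ≤ κ m := by
    intro m
    simp only [κ]
    push_cast
    have : (0 : ℝ) ≤ m := Nat.cast_nonneg m
    linarith
  have hκ2 : ∀ m < M, (κ m : ℝ) ≤ k₀ + 2 * √k₀ := by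
    intro m hm
    simp only [κ]
    push_cast
    have : (m : ℝ) + 1 ≤ M := by exact_mod_cast hm
    linarith
  have hterm : ∀ m ∈ Finset.range M, localConst d ^ 2 / (3 * k₀) ≤
      walkWeight (stepUp α) (stepDown α) (κ m) ((X : ℤ) + (Y : ℤ)) *
        walkWeight (stepUp β) (stepDown β) (κ m) ((X : ℤ) - (Y : ℤ)) := by
    intro m hm
    refine le_walkWeight_mul hα hβ (m := m₀ + m) (by omega) (by omega) rfl (by linarith) (hκ1 m)
      (hκ2 m (Finset.mem_range.1 hm)) hk₀T.symm ?_
    rw [← mul_left_inj' hT0.ne', hdir]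
    linear_combination (-Real.tanh β) * hk₀T
  have hinj : Set.InjOn κ (Finset.range M) := by
    intro a _ b _ hab
    simp only [κ] at hab
    omega
  have hle : ∑ m ∈ Finset.range M, walkWeight (stepUp α) (stepDown α) (κ m) ((X : ℤ) + (Y : ℤ)) *
        walkWeight (stepUp β) (stepDown β) (κ m) ((X : ℤ) - (Y : ℤ)) ≤
      ∑' k, walkWeight (stepUp α) (stepDown α) k ((X : ℤ) + (Y : ℤ)) *
        walkWeight (stepUp β) (stepDown β) k ((X : ℤ) - (Y : ℤ)) := by
    have := hsum.sum_le_tsum ((Finset.range M).image κ) (fun k _ =>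
      mul_nonneg (walkWeight_nonneg (stepUp_pos α).le (stepDown_pos α).le k _)
        (walkWeight_nonneg (stepUp_pos β).le (stepDown_pos β).le k _))
    rwa [Finset.sum_image hinj] at this
  refine le_trans ?_ hle
  refine le_trans ?_ (Finset.card_nsmul_le_sum _ _ _ hterm)
  rw [Finset.card_range, nsmul_eq_mul]
  have hM3 : √k₀ / 2 ≤ M := by
    have : (1 : ℝ) ≤ M := by exact_mod_cast hM0
    linarith
  have hc := localConst_pos d
  have hk₀s : √(1 - 1 / d) / √s ≤ 1 / √k₀ := by
    rw [← Real.sqrt_div hd1.le, ← Real.sqrt_one, ← Real.sqrt_div zero_le_one, Real.sqrt_one]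
    refine Real.sqrt_le_sqrt ?_
    rw [div_le_div_iff₀ (by linarith) hk₀0, hk₀, one_mul, mul_div_assoc', div_le_iff₀ hT0]
    nlinarith
  calc localConst d ^ 2 * √(1 - 1 / d) / 6 / √s
      = localConst d ^ 2 / 6 * (√(1 - 1 / d) / √s) := by ring
    _ ≤ localConst d ^ 2 / 6 * (1 / √k₀) := by gcongr
    _ = √k₀ / 2 * (localConst d ^ 2 / (3 * k₀)) := by
        have : 1 / √k₀ = √k₀ / k₀ := by
          rw [div_eq_div_iff (by positivity) hk₀0.ne', one_mul, hsqsq]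
        rw [this]
        ring
    _ ≤ _ := by gcongr

/-! ### Two-sided bounds for the Green function -/

theorem green_bounds_of_le {d : ℝ} (hd : 1 < d) {x y : ℤ} (hy : 0 ≤ y) (hyx : y ≤ x)
    (hx : 0 < x) :
    localConst d ^ 2 * √(1 - 1 / d) / 6 / (4 * d) *
        (Real.exp (-dualNorm d (toPlane (x, y))) / √((x + y : ℤ) : ℝ)) ≤ green d (x, y) ∧
      green d (x, y) ≤ 32 * d ^ 2 / (1 - 1 / d) / (4 * d) *
        (Real.exp (-dualNorm d (toPlane (x, y))) / √((x + y : ℤ) : ℝ)) := by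
  have hd0 : 0 < d := by linarith
  obtain ⟨ξ, η, t, hξ, hη, h, ht, e1, e2⟩ := exists_normal_of_le hd (a := x) (b := y)
    (by exact_mod_cast hy) (by exact_mod_cast hyx) (by exact_mod_cast hx)
  have hN : dualNorm d (toPlane (x, y)) = ξ * x + η * y := by
    have : toPlane (x, y) = t • !₂[Real.sinh ξ, Real.sinh η] := by
      rw [toPlane]
      simp only [e1, e2]
      ext i
      fin_cases i <;> simp
    rw [this, dualNorm_smul hd ht.le, dualNorm_gradient hd h, e1, e2]
    ring
  -- These are the tilts dual to `x + y` and `x - y`: `cosh ξ + cosh η = 2d` becomes `cosh α cosh β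
  -- = d`, and proportionality of `(x, y)` to the gradient becomes `hdir`.
  obtain ⟨α, β, rfl, rfl⟩ : ∃ α β : ℝ, ξ = α + β ∧ η = α - β :=
    ⟨(ξ + η) / 2, (ξ - η) / 2, by ring, by ring⟩
  have hsη : Real.sinh (α - β) ≤ Real.sinh (α + β) := by
    have : (y : ℝ) ≤ x := by exact_mod_cast hyx
    rw [e1, e2] at this
    exact le_of_mul_le_mul_left this ht
  have hβ0 : 0 ≤ β := by
    have := Real.sinh_le_sinh.1 hsη
    linarith
  have hα0 : 0 ≤ α := by linarith
  have hβα : β ≤ α := by linarith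
  have hcc : Real.cosh α * Real.cosh β = d := by
    rw [Real.cosh_add, Real.cosh_sub] at h
    linarith
  have hcβα : Real.cosh β ≤ Real.cosh α := by
    rw [Real.cosh_le_cosh, abs_of_nonneg hβ0, abs_of_nonneg hα0]
    exact hβα
  have h1α := Real.one_le_cosh α
  have h1β := Real.one_le_cosh β
  have hα : Real.cosh α ≤ d := by nlinarith
  have hβ : Real.cosh β ≤ d := by nlinarith
  have hα2 : d ≤ Real.cosh α ^ 2 := by nlinarith
  have hdir : ((x - y : ℤ) : ℝ) * Real.tanh α = ((x + y : ℤ) : ℝ) * Real.tanh β := by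
    push_cast
    rw [e1, e2, Real.tanh_eq_sinh_div_cosh, Real.tanh_eq_sinh_div_cosh, Real.sinh_add,
      Real.sinh_sub]
    field_simp
    ring
  have hterm := greenTerm_eq hd hcc (x + y) (x - y)
  have hexp : α * ((x + y : ℤ) : ℝ) + β * ((x - y : ℤ) : ℝ) =
      dualNorm d (toPlane (x, y)) := by
    rw [hN]
    push_cast
    ring
  rw [hexp] at hterm
  set E := Real.exp (-dualNorm d (toPlane (x, y))) with hE
  have hE0 : 0 < E := Real.exp_pos _
  have hEd : E / (4 * d) ≠ 0 := by positivity
  have hsum := summable_greenTerm hd (x + y) (x - y)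
  rw [summable_congr hterm, summable_mul_left_iff hEd] at hsum
  have hg : green d (x, y) = E / (4 * d) * ∑' k, walkWeight (stepUp α) (stepDown α) k (x + y) *
        walkWeight (stepUp β) (stepDown β) k (x - y) := by
    rw [green, tsum_congr hterm, tsum_mul_left]
  rw [hg]
  constructor
  · have := le_tsum_walkWeight_mul hd hα0 hα hα2 hβ hy hyx hx hdir hsum
    calc _ = E / (4 * d) * (localConst d ^ 2 * √(1 - 1 / d) / 6 / √((x + y : ℤ) : ℝ)) := by ring
      _ ≤ _ := mul_le_mul_of_nonneg_left this (by positivity)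
  · have := hsum.tsum_le_of_sum_range_le
      (sum_walkWeight_mul_le hd hα0 hα2 hβ (s := x + y) (t := x - y) (by omega) (by omega))
    calc _ ≤ E / (4 * d) * (32 * d ^ 2 / (1 - 1 / d) / √((x + y : ℤ) : ℝ)) :=
          mul_le_mul_of_nonneg_left this (by positivity)
      _ = _ := by ring

theorem norm_toPlane (x y : ℤ) : ‖toPlane (x, y)‖ = √((x : ℝ) ^ 2 + (y : ℝ) ^ 2) := by
  simp [toPlane, EuclideanSpace.norm_eq, Fin.sum_univ_two]

/-- Ornstein–Zernike bounds for the Green function. -/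
theorem exists_green_bounds {d : ℝ} (hd : 1 < d) : ∃ c C : ℝ, 0 < c ∧ 0 < C ∧ ∀ x : Site,
    x ≠ (0, 0) →
      c * (Real.exp (-dualNorm d (toPlane x)) / √‖toPlane x‖) ≤ green d x ∧
      green d x ≤ C * (Real.exp (-dualNorm d (toPlane x)) / √‖toPlane x‖) := by
  have hd0 : 0 < d := by linarith
  have hd1 : 0 < 1 - 1 / d := by
    rw [sub_pos, div_lt_one (by linarith)]
    exact hd
  have hc := localConst_pos d
  set c := localConst d ^ 2 * √(1 - 1 / d) / 6 / (4 * d) with hcdef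
  set C := 32 * d ^ 2 / (1 - 1 / d) / (4 * d) with hCdef
  have hc0 : 0 < c := by positivity
  have hC0 : 0 < C := by positivity
  have key : ∀ x y : ℤ, 0 ≤ y → y ≤ x → 0 < x →
      c / √2 * (Real.exp (-dualNorm d (toPlane (x, y))) / √‖toPlane (x, y)‖) ≤ green d (x, y) ∧
      green d (x, y) ≤ C * (Real.exp (-dualNorm d (toPlane (x, y))) / √‖toPlane (x, y)‖) := by
    intro x y hy hyx hx
    obtain ⟨h1, h2⟩ := green_bounds_of_le hd hy hyx hx
    set E := Real.exp (-dualNorm d (toPlane (x, y)))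
    have hE0 : 0 < E := Real.exp_pos _
    have hxr : (0 : ℝ) < x := by exact_mod_cast hx
    have hyr : (0 : ℝ) ≤ y := by exact_mod_cast hy
    have hyxr : (y : ℝ) ≤ x := by exact_mod_cast hyx
    have hn1 : ‖toPlane (x, y)‖ ≤ ((x + y : ℤ) : ℝ) := by
      rw [norm_toPlane]
      push_cast
      exact Real.sqrt_le_iff.2 ⟨by positivity, by nlinarith⟩
    have hn2 : ((x + y : ℤ) : ℝ) ≤ 2 * ‖toPlane (x, y)‖ := by
      have : (x : ℝ) ≤ ‖toPlane (x, y)‖ := by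
        rw [norm_toPlane]
        exact Real.le_sqrt_of_sq_le (by nlinarith)
      push_cast
      linarith
    have hn0 : 0 < ‖toPlane (x, y)‖ := by
      rw [norm_toPlane]
      positivity
    constructor
    · refine le_trans ?_ h1
      calc c / √2 * (E / √‖toPlane (x, y)‖) = c * (E / √(2 * ‖toPlane (x, y)‖)) := by
            rw [Real.sqrt_mul (by norm_num)]
            field_simp
        _ ≤ c * (E / √((x + y : ℤ) : ℝ)) := by
            have : 0 < √((x + y : ℤ) : ℝ) := Real.sqrt_pos.2 (by push_cast; positivity)
            gcongr
    · refine h2.trans ?_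
      gcongr
  refine ⟨c / √2, C, by positivity, hC0, ?_⟩
  rintro ⟨x, y⟩ hxy
  have hne : x ≠ 0 ∨ y ≠ 0 := by
    by_contra! h
    exact hxy (by rw [h.1, h.2])
  have hNabs : dualNorm d (toPlane (|x|, |y|)) = dualNorm d (toPlane (x, y)) := by
    simp only [toPlane, Int.cast_abs]
    exact dualNorm_abs hd _ _
  have hnabs : ‖toPlane (|x|, |y|)‖ = ‖toPlane (x, y)‖ := by
    simp [norm_toPlane]
  rcases le_total |y| |x| with h | h
  · have := key |x| |y| (abs_nonneg y) h (by
      rcases hne with h' | h'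
      · exact abs_pos.2 h'
      · exact (abs_pos.2 h').trans_le h)
    rwa [green_abs, hNabs, hnabs] at this
  · have := key |y| |x| (abs_nonneg x) h (by
      rcases hne with h' | h'
      · exact (abs_pos.2 h').trans_le h
      · exact abs_pos.2 h')
    have hsw : dualNorm d (toPlane (|y|, |x|)) = dualNorm d (toPlane (|x|, |y|)) :=
      dualNorm_swap hd _ _
    have hnsw : ‖toPlane (|y|, |x|)‖ = ‖toPlane (|x|, |y|)‖ := by
      rw [norm_toPlane, norm_toPlane, add_comm]
    rwa [green_swap, green_abs, hsw, hnsw, hNabs, hnabs] at this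

/-! ### Comparison of the odometer with the Green function -/

/-- The infimum `m` need not be attained, but averaging over neighbours gives `m / d ≤ m`, which
excludes `m < 0` as `d > 1`. -/
theorem nonneg_of_superharmonic {d : ℝ} (hd : 1 < d) {w : Site → ℝ} {B : ℝ} (hB : ∀ x, B ≤ w x)
    (h : ∀ x : Site, w (x.1 - 1, x.2) + w (x.1 + 1, x.2) + w (x.1, x.2 - 1) + w (x.1, x.2 + 1) ≤
      4 * d * w x) (x : Site) : 0 ≤ w x := by
  have hbdd : BddBelow (range w) := ⟨B, by rintro _ ⟨y, rfl⟩; exact hB y⟩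
  have hd0 : 0 < d := by linarith
  set m := ⨅ y, w y with hm
  have hmw : ∀ y, m ≤ w y := fun y => ciInf_le hbdd y
  have h1 : m / d ≤ m := by
    refine le_ciInf fun y => ?_
    rw [div_le_iff₀ hd0]
    have := h y
    linarith [hmw (y.1 - 1, y.2), hmw (y.1 + 1, y.2), hmw (y.1, y.2 - 1), hmw (y.1, y.2 + 1)]
  rw [div_le_iff₀ hd0] at h1
  have : 0 ≤ m := by nlinarith
  exact this.trans (hmw x)

theorem run_nonneg {d : ℝ} (l : List Site) : ∀ s : Sandpile, (∀ y, 0 ≤ s y) → IsLegal d s l →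
    ∀ y, 0 ≤ run d s l y := by
  induction l with
  | nil => intro s h0 _; exact h0
  | cons x l ih =>
    intro s h0 hl
    refine ih _ (fun y => ?_) hl.2
    have hy : 0 ≤ s y - (if y = x then 4 * d else 0) := by
      by_cases h : y = x
      · subst h
        simpa using hl.1
      · simpa [h] using h0 y
    unfold topple
    have hi : ∀ p : Prop, ∀ [Decidable p], (0 : ℝ) ≤ if p then 1 else 0 := by
      intro p _
      split_ifs <;> norm_num
    linarith [hi (y = (x.1 + 1, x.2)), hi (y = (x.1 - 1, x.2)), hi (y = (x.1, x.2 + 1)),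
      hi (y = (x.1, x.2 - 1))]

theorem pointPile_eq (n : ℕ) (x : Site) :
    pointPile n x = n * (if x = (0, 0) then (1 : ℝ) else 0) := by
  unfold pointPile
  split_ifs <;> simp

/-- The final pile is nonnegative, so `n g` minus the odometer is superharmonic; a visited site has
odometer at least 1. -/
theorem one_le_of_mem_visited {d : ℝ} (hd : 1 < d) {n : ℕ} {x : Site} (hx : x ∈ visited d n) :
    1 ≤ n * green d x := by
  obtain ⟨l, hl, hxl⟩ := hx
  have hpile : ∀ y, 0 ≤ pointPile n y := by
    intro y
    unfold pointPile
    split_ifs <;> simp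
  have key := nonneg_of_superharmonic hd (w := fun y => n * green d y - (l.count y : ℝ))
    (B := -(l.length : ℝ)) (fun y => by
      have h1 : (l.count y : ℝ) ≤ l.length := by exact_mod_cast List.count_le_length
      have h2 : 0 ≤ n * green d y := mul_nonneg (Nat.cast_nonneg n) (green_nonneg hd y)
      linarith) (fun y => by
      have h1 := run_nonneg l _ hpile hl.1 y
      rw [run_apply, pointPile_eq] at h1
      have h2 := congrArg (fun r => (n : ℝ) * r) (green_equation hd y)
      simp only [mul_add] at h2
      linarith) x
  have h1 : (1 : ℝ) ≤ l.count x := by exact_mod_cast List.count_pos_iff.2 hxl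
  linarith

theorem le_of_notMem_visited {d : ℝ} (hd : 1 < d) {n : ℕ} {x : Site} (hx : x ∉ visited d n) :
    n * green d x ≤ d / (d - 1) := by
  obtain ⟨l, hl⟩ := exists_isStabilization d hd n
  rw [visited_eq d n l hl] at hx
  have hd1 : 0 < d - 1 := by linarith
  have key := nonneg_of_superharmonic hd
    -- The constant solves `(4d - 4) c = 4d`, which compensates a final pile below `4d`.
    (w := fun y => (l.count y : ℝ) - n * green d y + d / (d - 1))
    (B := -(n * ∑' k : ℕ, d⁻¹ ^ k)) (fun y => by
      have h1 : (0 : ℝ) ≤ l.count y := Nat.cast_nonneg _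
      have h2 := mul_le_mul_of_nonneg_left (green_le hd y) (Nat.cast_nonneg (α := ℝ) n)
      have h3 : 0 ≤ d / (d - 1) := by positivity
      linarith) (fun y => by
      have h1 := hl.2 y
      rw [run_apply, pointPile_eq] at h1
      have h2 := congrArg (fun r => (n : ℝ) * r) (green_equation hd y)
      simp only [mul_add] at h2
      have h3 : 4 * d * (d / (d - 1)) = 4 * (d / (d - 1)) + 4 * d := by
        field_simp
        ring
      linarith) x
  have h1 : l.count x = 0 := List.count_eq_zero.2 hx
  simp only [h1, Nat.cast_zero] at key
  linarith

/-! ### The visited set between two balls of the dual norm -/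

theorem abs_coord_le_norm (x : Plane) (i : Fin 2) : |x i| ≤ ‖x‖ := by
  simpa using EuclideanSpace.norm_eq x ▸ PiLp.norm_apply_le x i

theorem norm_le_abs_add_abs (x : Plane) : ‖x‖ ≤ |x 0| + |x 1| := by
  rw [EuclideanSpace.norm_eq, Fin.sum_univ_two]
  refine Real.sqrt_le_iff.2 ⟨by positivity, ?_⟩
  simp only [Real.norm_eq_abs]
  nlinarith [abs_nonneg (x 0), abs_nonneg (x 1)]

theorem dualNorm_le_mul_norm {d : ℝ} (hd : 1 < d) (x : Plane) : dualNorm d x ≤ 4 * d * ‖x‖ := by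
  refine dualNorm_le hd fun p hp => ?_
  have h : ∀ i, p i * x i ≤ 2 * d * ‖x‖ := fun i =>
    (le_abs_self _).trans (by
      rw [abs_mul]
      exact mul_le_mul (abs_le_of_coshSum_le hp i) (abs_coord_le_norm x i) (abs_nonneg _)
        (by linarith))
  linarith [h 0, h 1]

theorem dualNorm_le_add {d : ℝ} (hd : 1 < d) (x y : Plane) :
    dualNorm d x ≤ dualNorm d y + 4 * d * dist x y := by
  have h1 := dualNorm_add_le hd y (x - y)
  rw [add_sub_cancel] at h1
  have h2 := dualNorm_le_mul_norm hd (x - y)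
  rw [dist_eq_norm]
  linarith

/-- The diagonal boundary point `(arcosh d, arcosh d)` is tested against `(|x 0|, |x 1|)`. -/
theorem arcosh_mul_norm_le {d : ℝ} (hd : 1 < d) (x : Plane) :
    Real.arcosh d * ‖x‖ ≤ dualNorm d x := by
  have hr := Real.arcosh_pos hd
  have h1 := le_dualNorm (d := d) (p := !₂[Real.arcosh d, Real.arcosh d]) (by
    simp [coshSum, Real.cosh_arcosh hd.le]
    linarith) !₂[|x 0|, |x 1|]
  rw [dualNorm_abs hd, ← eq_toLp] at h1
  simp only [Matrix.cons_val_zero, Matrix.cons_val_one] at h1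
  have h2 := mul_le_mul_of_nonneg_left (norm_le_abs_add_abs x) hr.le
  linarith

theorem scale_bounds {n : ℕ} (hn : 1 ≤ Real.log n) :
    1 / 2 * Real.log n ≤ scale n ∧ scale n ≤ Real.log n := by
  have h1 := Real.log_le_sub_one_of_pos (show 0 < Real.log n by linarith)
  have h2 := Real.log_nonneg hn
  unfold scale
  constructor <;> linarith

theorem tendsto_log_natCast : Tendsto (fun n : ℕ => Real.log n) atTop atTop :=
  Real.tendsto_log_atTop.comp tendsto_natCast_atTop_atTop

theorem tendsto_scale : Tendsto scale atTop atTop := by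
  have h : Tendsto (fun n : ℕ => 1 / 2 * Real.log n) atTop atTop :=
    tendsto_log_natCast.const_mul_atTop (by norm_num)
  refine tendsto_atTop_mono' _ ?_ h
  filter_upwards [tendsto_log_natCast.eventually_ge_atTop 1] with n hn
  exact (scale_bounds hn).1

theorem log_mul_exp_div_sqrt {a b N r : ℝ} (ha : 0 < a) (hb : 0 < b) (hr : 0 < r) :
    Real.log (a * (b * (Real.exp (-N) / √r))) =
      Real.log a + Real.log b - N - 1 / 2 * Real.log r := by
  have h : 0 < √r := Real.sqrt_pos.2 hr
  rw [Real.log_mul ha.ne' (by positivity), Real.log_mul hb.ne' (by positivity),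
    Real.log_div (Real.exp_pos _).ne' h.ne', Real.log_exp, Real.log_sqrt hr.le]
  ring

theorem toPlane_zero : toPlane (0, 0) = 0 := by
  ext i
  fin_cases i <;> simp [toPlane]

theorem norm_toPlane_pos {x : Site} (hx : x ≠ (0, 0)) : 0 < ‖toPlane x‖ := by
  rw [norm_pos_iff]
  intro h
  apply hx
  have h0 := congrArg (fun p : Plane => p 0) h
  have h1 := congrArg (fun p : Plane => p 1) h
  simp [toPlane] at h0 h1
  exact Prod.ext h0 h1

/-- Taking logarithms of the Green bounds leaves the term `(1/2) log |x|`. If `N x` is at most the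
scale, then `|x|` is at most a multiple of `log n`; if it exceeds the scale, `|x|` is at least such
a multiple. Each inclusion needs only one of these. -/
theorem visited_sandwich {d : ℝ} (hd : 1 < d) : ∃ K : ℝ, 0 < K ∧ ∀ᶠ n : ℕ in atTop, ∀ x : Site,
    (dualNorm d (toPlane x) ≤ scale n - K → x ∈ visited d n) ∧
    (x ∈ visited d n → dualNorm d (toPlane x) ≤ scale n + K) := by
  obtain ⟨c, C, hc, hC, hG⟩ := exists_green_bounds hd
  have hd0 : 0 < d := by linarith
  have hd1 : 0 < d - 1 := by linarith
  have hr := Real.arcosh_pos hd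
  set r := Real.arcosh d
  set K₁ := Real.log (d / (d - 1)) - Real.log c - 1 / 2 * Real.log r with hK₁
  -- The `8d` arises from `N ≥ (1/2) log n` together with `N ≤ 4d |x|`.
  set K₂ := Real.log C + 1 / 2 * Real.log (8 * d) with hK₂
  refine ⟨|K₁| + |K₂| + 1, by positivity, ?_⟩
  filter_upwards [tendsto_log_natCast.eventually_ge_atTop 1,
    tendsto_natCast_atTop_atTop.eventually_gt_atTop (4 * d * (d / (d - 1)))] with n hn hn2
  obtain ⟨hs1, hs2⟩ := scale_bounds hn
  have hn0 : (0 : ℝ) < n := lt_trans (by positivity) hn2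
  have hsc : scale n = Real.log n - 1 / 2 * Real.log (Real.log n) := rfl
  have hK₁a := le_abs_self K₁
  have hK₂a := le_abs_self K₂
  have hK₁n := abs_nonneg K₁
  have hK₂n := abs_nonneg K₂
  intro x
  -- The Green bounds exclude the origin; it is visited because `4d g(0) ≥ 1` and `n > 4d ·
  -- d/(d-1)`.
  by_cases hx : x = (0, 0)
  · subst hx
    rw [toPlane_zero, dualNorm_zero hd]
    refine ⟨fun _ => ?_, fun _ => by linarith⟩
    by_contra hcon
    have h1 := le_of_notMem_visited hd hcon
    have h2 := green_equation hd (0, 0)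
    rw [if_pos rfl] at h2
    have h3 : 1 ≤ 4 * d * green d (0, 0) := by
      linarith [green_nonneg hd ((0, 0).1 - 1, (0, 0).2), green_nonneg hd ((0, 0).1 + 1, (0, 0).2),
        green_nonneg hd ((0, 0).1, (0, 0).2 - 1), green_nonneg hd ((0, 0).1, (0, 0).2 + 1)]
    have h4 := mul_le_mul_of_nonneg_left h1 (show 0 ≤ 4 * d by linarith)
    nlinarith
  obtain ⟨hG1, hG2⟩ := hG x hx
  have hx0 := norm_toPlane_pos hx
  set N := dualNorm d (toPlane x)
  have hN1 : r * ‖toPlane x‖ ≤ N := arcosh_mul_norm_le hd _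
  have hN2 : N ≤ 4 * d * ‖toPlane x‖ := dualNorm_le_mul_norm hd _
  have hsq : 0 < √‖toPlane x‖ := Real.sqrt_pos.2 hx0
  constructor
  · intro hle
    by_contra hcon
    have h1 := le_of_notMem_visited hd hcon
    have h2 : n * (c * (Real.exp (-N) / √‖toPlane x‖)) ≤ d / (d - 1) :=
      (mul_le_mul_of_nonneg_left hG1 hn0.le).trans h1
    have h3 := Real.log_le_log (by positivity) h2
    rw [log_mul_exp_div_sqrt hn0 hc hx0] at h3
    have h4 : Real.log ‖toPlane x‖ ≤ Real.log (Real.log n) - Real.log r := by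
      rw [← Real.log_div (by linarith) hr.ne']
      refine Real.log_le_log hx0 ?_
      rw [le_div_iff₀ hr]
      linarith
    linarith
  · intro hmem
    by_contra! hcon
    have h1 := one_le_of_mem_visited hd hmem
    have h2 : 1 ≤ n * (C * (Real.exp (-N) / √‖toPlane x‖)) :=
      h1.trans (mul_le_mul_of_nonneg_left hG2 hn0.le)
    have h3 := Real.log_le_log one_pos h2
    rw [log_mul_exp_div_sqrt hn0 hC hx0, Real.log_one] at h3
    have h4 : Real.log (Real.log n) - Real.log (8 * d) ≤ Real.log ‖toPlane x‖ := by
      rw [← Real.log_div (by linarith) (by positivity)]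
      refine Real.log_le_log (by positivity) ?_
      rw [div_le_iff₀ (by positivity)]
      linarith
    linarith

/-! ### Discrete geometry of the boundary -/

/-- A shortest lattice path from `x` to `y` must leave `D`; the last site before its first exit is a
boundary site. -/
theorem exists_boundary_near (D : Set Site) (m : ℕ) : ∀ x y : Site, x ∈ D → y ∉ D →
    (y.1 - x.1).natAbs + (y.2 - x.2).natAbs = m →
    ∃ z : Site, toPlane z ∈ latticeBoundary D ∧
      (z.1 - x.1).natAbs + (z.2 - x.2).natAbs ≤ m := by
  induction m with
  | zero =>
    intro x y hx hy h
    exact absurd hx (by rwa [show x = y from Prod.ext (by omega) (by omega)])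
  | succ m ih =>
    intro x y hx hy h
    obtain ⟨x', hx', hd', hn⟩ : ∃ x' : Site,
        (y.1 - x'.1).natAbs + (y.2 - x'.2).natAbs = m ∧
        (x'.1 - x.1).natAbs + (x'.2 - x.2).natAbs ≤ 1 ∧
        (x' = (x.1 + 1, x.2) ∨ x' = (x.1 - 1, x.2) ∨ x' = (x.1, x.2 + 1) ∨
          x' = (x.1, x.2 - 1)) := by
      rcases lt_trichotomy x.1 y.1 with h1 | h1 | h1
      · exact ⟨(x.1 + 1, x.2), by dsimp only; omega, by dsimp only; omega, by simp⟩
      · rcases lt_trichotomy x.2 y.2 with h2 | h2 | h2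
        · exact ⟨(x.1, x.2 + 1), by dsimp only; omega, by dsimp only; omega, by simp⟩
        · omega
        · exact ⟨(x.1, x.2 - 1), by dsimp only; omega, by dsimp only; omega, by simp⟩
      · exact ⟨(x.1 - 1, x.2), by dsimp only; omega, by dsimp only; omega, by simp⟩
    by_cases hD : x' ∈ D
    · obtain ⟨z, hz, hzm⟩ := ih x' y hD hy hx'
      exact ⟨z, hz, by omega⟩
    · refine ⟨x, ⟨x, ⟨hx, ?_⟩, rfl⟩, by simp⟩
      rcases hn with rfl | rfl | rfl | rfl <;> simp [hD]

theorem dist_toPlane_le (x y : Site) :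
    dist (toPlane x) (toPlane y) ≤ |(x.1 : ℝ) - y.1| + |(x.2 : ℝ) - y.2| := by
  rw [dist_eq_norm]
  simpa [toPlane] using norm_le_abs_add_abs (toPlane x - toPlane y)

theorem exists_notMem_of_mem_latticeBoundary {D : Set Site} {p : Plane}
    (hp : p ∈ latticeBoundary D) : ∃ x y : Site, p = toPlane x ∧ x ∈ D ∧ y ∉ D ∧
      dist (toPlane y) (toPlane x) ≤ 1 := by
  obtain ⟨x, ⟨hx, h⟩, rfl⟩ := hp
  rcases h with h | h | h | h <;>
    exact ⟨x, _, rfl, hx, h, (dist_toPlane_le _ _).trans (by simp)⟩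

/-- A lattice point near a point of the plane. -/
def floorSite (p : Plane) : Site := (⌊p 0⌋, ⌊p 1⌋)

theorem abs_floor_sub_le (a : ℝ) : |(⌊a⌋ : ℝ) - a| ≤ 1 := by
  rw [abs_le]
  constructor <;> linarith [Int.floor_le a, Int.lt_floor_add_one a]

theorem dist_floorSite_le (p : Plane) : dist (toPlane (floorSite p)) p ≤ 2 := by
  rw [dist_eq_norm]
  refine (norm_le_abs_add_abs _).trans ?_
  have h0 := abs_floor_sub_le (p 0)
  have h1 := abs_floor_sub_le (p 1)
  simp [toPlane, floorSite]
  linarith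

/-! ### From the two-ball sandwich to distances from the curve -/

section Shape

variable {d R K : ℝ} {D : Set Site}

theorem norm_le_of_mem_limitCurve (hd : 1 < d) {y : Plane} (hy : dualNorm d y = 1) :
    ‖y‖ ≤ 1 / Real.arcosh d := by
  rw [le_div_iff₀ (Real.arcosh_pos hd), mul_comm, ← hy]
  exact arcosh_mul_norm_le hd y

/-- A boundary site has a neighbour outside `D`, which pins its dual norm `N` to `R` within `K +
4d`. Radial projection onto the curve moves it by `|N - R| / N` times its length, and `|x| ≤ N /
arcosh d`. -/
theorem boundary_near_curve (hd : 1 < d) (hK : 0 < K) (hR : K + 4 * d < R)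
    (h1 : ∀ x, dualNorm d (toPlane x) ≤ R - K → x ∈ D)
    (h2 : ∀ x ∈ D, dualNorm d (toPlane x) ≤ R + K) {p : Plane} (hp : p ∈ latticeBoundary D) :
    ∃ q ∈ R • limitCurve d, dist p q ≤ (K + 4 * d) / Real.arcosh d := by
  obtain ⟨x, y, rfl, hx, hy, hxy⟩ := exists_notMem_of_mem_latticeBoundary hp
  have hr := Real.arcosh_pos hd
  have hNx := h2 x hx
  have hNy : R - K < dualNorm d (toPlane y) := not_le.1 fun h => hy (h1 y h)
  have h3 := dualNorm_le_add hd (toPlane y) (toPlane x)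
  set N := dualNorm d (toPlane x) with hN
  have h4 : 4 * d * dist (toPlane y) (toPlane x) ≤ 4 * d :=
    mul_le_of_le_one_right (by linarith) hxy
  have hN0 : 0 < N := by linarith
  refine ⟨R • (N⁻¹ • toPlane x), smul_mem_smul_set ?_, ?_⟩
  · rw [limitCurve_eq_sphere hd, mem_ofPred_eq, dualNorm_smul hd (inv_pos.2 hN0).le, ← hN,
      inv_mul_cancel₀ hN0.ne']
  · have e : toPlane x - R • (N⁻¹ • toPlane x) = ((N - R) / N) • toPlane x := by
      rw [smul_smul, sub_div, div_self hN0.ne', sub_smul, one_smul, div_eq_mul_inv]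
    rw [dist_eq_norm, e, norm_smul, Real.norm_eq_abs, abs_div, abs_of_pos hN0, div_mul_eq_mul_div,
      div_le_div_iff₀ hN0 hr]
    have h5 : |N - R| ≤ K + 4 * d := by
      rw [abs_le]
      constructor <;> linarith
    have h6 := arcosh_mul_norm_le hd (toPlane x)
    calc |N - R| * ‖toPlane x‖ * Real.arcosh d
        = |N - R| * (Real.arcosh d * ‖toPlane x‖) := by ring
      _ ≤ (K + 4 * d) * N := mul_le_mul h5 h6 (by positivity) (by linarith)

theorem curve_near_boundary (hd : 1 < d) (hK : 0 < K) (hR : K + 8 * d + 1 < R)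
    (h1 : ∀ x, dualNorm d (toPlane x) ≤ R - K → x ∈ D)
    (h2 : ∀ x ∈ D, dualNorm d (toPlane x) ≤ R + K) {q : Plane} (hq : q ∈ R • limitCurve d) :
    ∃ p ∈ latticeBoundary D, dist p q ≤ 5 * (K + 8 * d + 1) / Real.arcosh d + 6 := by
  obtain ⟨y, hy, rfl⟩ := hq
  rw [limitCurve_eq_sphere hd] at hy
  have hynorm := norm_le_of_mem_limitCurve hd hy
  have hr := Real.arcosh_pos hd
  -- Rounding to a site moves a point by at most 2, hence its dual norm by at most `8d`; the extra 1
  -- makes the outer inequality strict.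
  set A := K + 8 * d + 1 with hA
  set x₀ := floorSite ((R - A) • y) with hx₀
  set x₁ := floorSite ((R + A) • y) with hx₁
  have hd₀ : dist (toPlane x₀) ((R - A) • y) ≤ 2 := dist_floorSite_le _
  have hd₁ : dist (toPlane x₁) ((R + A) • y) ≤ 2 := dist_floorSite_le _
  have hx₀D : x₀ ∈ D := by
    apply h1
    have h3 := dualNorm_le_add hd (toPlane x₀) ((R - A) • y)
    rw [dualNorm_smul hd (by linarith), hy] at h3
    nlinarith
  have hx₁D : x₁ ∉ D := by
    intro h
    have h3 := h2 x₁ h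
    have h4 := dualNorm_le_add hd ((R + A) • y) (toPlane x₁)
    rw [dualNorm_smul hd (by linarith), hy, dist_comm] at h4
    nlinarith
  obtain ⟨z, hz, hzm⟩ := exists_boundary_near D _ x₀ x₁ hx₀D hx₁D rfl
  refine ⟨toPlane z, hz, ?_⟩
  have hcoord : ∀ i : Fin 2, |(⌊(R + A) * y i⌋ : ℝ) - ⌊(R - A) * y i⌋| ≤
      2 * A * (1 / Real.arcosh d) + 2 := by
    intro i
    have e1 := abs_floor_sub_le ((R + A) * y i)
    have e2 := abs_floor_sub_le ((R - A) * y i)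
    have e3 : |2 * A * y i| ≤ 2 * A * (1 / Real.arcosh d) := by
      rw [abs_mul, abs_of_pos (by linarith)]
      exact mul_le_mul_of_nonneg_left ((abs_coord_le_norm y i).trans hynorm) (by linarith)
    rw [abs_le] at e1 e2 e3 ⊢
    constructor <;> linarith
  have hl1 : |(z.1 : ℝ) - x₀.1| + |(z.2 : ℝ) - x₀.2| ≤ 4 * A * (1 / Real.arcosh d) + 4 := by
    have e : ((((z.1 - x₀.1).natAbs + (z.2 - x₀.2).natAbs : ℕ) : ℤ) : ℝ) ≤
        ((((x₁.1 - x₀.1).natAbs + (x₁.2 - x₀.2).natAbs : ℕ) : ℤ) : ℝ) := by exact_mod_cast hzm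
    simp only [Nat.cast_add, Int.natCast_natAbs, Int.cast_add, Int.cast_abs, Int.cast_sub] at e
    refine e.trans ?_
    have e0 := hcoord 0
    have e1 := hcoord 1
    simp only [hx₀, hx₁, floorSite, PiLp.smul_apply, smul_eq_mul]
    linarith
  have h5 : dist ((R - A) • y) (R • y) ≤ A * (1 / Real.arcosh d) := by
    rw [dist_eq_norm, ← sub_smul, norm_smul, Real.norm_eq_abs, show R - A - R = -A by ring, abs_neg,
      abs_of_pos (by linarith)]
    exact mul_le_mul_of_nonneg_left hynorm (by linarith)
  have h6 := dist_toPlane_le z x₀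
  have h7 := dist_triangle4 (toPlane z) (toPlane x₀) ((R - A) • y) (R • y)
  have h8 : 5 * A / Real.arcosh d = 5 * A * (1 / Real.arcosh d) := by ring
  rw [h8]
  change dist (toPlane z) (R • y) ≤ _
  linarith

/-- On the ray through `y` the dual norm of `x` is exactly `t`, so the sandwich in `t` becomes one
in length after multiplication by `|y|`. -/
theorem radial_bounds (hd : 1 < d) (hK : 0 < K)
    (h1 : ∀ x, dualNorm d (toPlane x) ≤ R - K → x ∈ D)
    (h2 : ∀ x ∈ D, dualNorm d (toPlane x) ≤ R + K) {h : ℝ} (hh : K / Real.arcosh d ≤ h) (x : Site)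
    (y : Plane) (t : ℝ) (hy : y ∈ limitCurve d) (ht : 0 ≤ t) (hx : toPlane x = t • y) :
    (‖toPlane x‖ ≤ R * ‖y‖ - h → x ∈ D) ∧ (x ∈ D → ‖toPlane x‖ ≤ R * ‖y‖ + h) := by
  rw [limitCurve_eq_sphere hd] at hy
  have hynorm := norm_le_of_mem_limitCurve hd hy
  have hy0 : 0 < ‖y‖ := by
    rw [norm_pos_iff]
    rintro rfl
    rw [mem_ofPred_eq, dualNorm_zero hd] at hy
    norm_num at hy
  have hNx : dualNorm d (toPlane x) = t := by
    rw [hx, dualNorm_smul hd ht, hy, mul_one]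
  have hnorm : ‖toPlane x‖ = t * ‖y‖ := by
    rw [hx, norm_smul, Real.norm_of_nonneg ht]
  have hKy : K * ‖y‖ ≤ h := by
    refine le_trans ?_ hh
    rw [div_eq_mul_one_div]
    exact mul_le_mul_of_nonneg_left hynorm hK.le
  rw [hnorm]
  constructor
  · intro hle
    apply h1
    rw [hNx]
    have : t * ‖y‖ ≤ (R - K) * ‖y‖ := by linarith
    exact le_of_mul_le_mul_right this hy0
  · intro hmem
    have h3 := h2 x hmem
    rw [hNx] at h3
    have := mul_le_mul_of_nonneg_right h3 hy0.le
    linarith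

end Shape

theorem hausdorffEDist_smul_le {R h : ℝ} (hR : 0 < R) {B Γ : Set Plane}
    (h1 : ∀ p ∈ B, ∃ q ∈ R • Γ, dist p q ≤ h) (h2 : ∀ q ∈ R • Γ, ∃ p ∈ B, dist p q ≤ h) :
    Metric.hausdorffEDist (R⁻¹ • B) Γ ≤ ENNReal.ofReal (h / R) := by
  have key : ∀ p y : Plane, dist p (R • y) ≤ h → edist (R⁻¹ • p) y ≤ ENNReal.ofReal (h / R) := by
    intro p y hpy
    rw [edist_dist]
    apply ENNReal.ofReal_le_ofReal
    rw [le_div_iff₀ hR]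
    refine le_trans (le_of_eq ?_) hpy
    have e : p - R • y = R • (R⁻¹ • p - y) := by
      rw [smul_sub, smul_smul, mul_inv_cancel₀ hR.ne', one_smul]
    rw [dist_eq_norm, dist_eq_norm, e, norm_smul, Real.norm_of_nonneg hR.le, mul_comm]
  refine Metric.hausdorffEDist_le_of_mem_edist ?_ ?_
  · rintro _ ⟨p, hp, rfl⟩
    obtain ⟨_, ⟨y, hy, rfl⟩, hpy⟩ := h1 p hp
    exact ⟨y, hy, key p y hpy⟩
  · intro y hy
    obtain ⟨p, hp, hpy⟩ := h2 _ (smul_mem_smul_set hy)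
    exact ⟨_, smul_mem_smul_set hp, by rw [edist_comm]; exact key p y hpy⟩

theorem exists_shape_const {d : ℝ} (hd : 1 < d) : ∃ h : ℝ, 0 < h ∧ ∀ᶠ n : ℕ in atTop,
    (∀ p ∈ latticeBoundary (visited d n), ∃ q ∈ scale n • limitCurve d, dist p q ≤ h) ∧
    (∀ q ∈ scale n • limitCurve d, ∃ p ∈ latticeBoundary (visited d n), dist p q ≤ h) ∧
    (∀ (x : ℤ × ℤ) (y : Plane) (t : ℝ), y ∈ limitCurve d → 0 ≤ t → toPlane x = t • y →
      (‖toPlane x‖ ≤ scale n * ‖y‖ - h → x ∈ visited d n) ∧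
      (x ∈ visited d n → ‖toPlane x‖ ≤ scale n * ‖y‖ + h)) := by
  obtain ⟨K, hK, hsand⟩ := visited_sandwich hd
  have hr := Real.arcosh_pos hd
  refine ⟨5 * (K + 8 * d + 1) / Real.arcosh d + 6, by positivity, ?_⟩
  filter_upwards [hsand, tendsto_scale.eventually_gt_atTop (K + 8 * d + 1)] with n hn hR
  have h1 := fun x => (hn x).1
  have h2 := fun x => (hn x).2
  refine ⟨fun p hp => ?_, fun q hq => curve_near_boundary hd hK hR h1 h2 hq,
    radial_bounds hd hK h1 h2 ?_⟩
  · obtain ⟨q, hq, hpq⟩ := boundary_near_curve hd hK (by linarith) h1 h2 hp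
    refine ⟨q, hq, hpq.trans ?_⟩
    have : (K + 4 * d) / Real.arcosh d ≤ 5 * (K + 8 * d + 1) / Real.arcosh d :=
      div_le_div_of_nonneg_right (by linarith) hr.le
    linarith
  · have : K / Real.arcosh d ≤ 5 * (K + 8 * d + 1) / Real.arcosh d :=
      div_le_div_of_nonneg_right (by linarith) hr.le
    linarith

theorem tendsto_hausdorffEDist {d : ℝ} (hd : 1 < d) :
    Tendsto (fun n : ℕ => Metric.hausdorffEDist
      ((scale n)⁻¹ • latticeBoundary (visited d n)) (limitCurve d)) atTop (𝓝 0) := by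
  obtain ⟨h, -, hev⟩ := exists_shape_const hd
  have hlim : Tendsto (fun n : ℕ => ENNReal.ofReal (h / scale n)) atTop (𝓝 0) := by
    rw [← ENNReal.ofReal_zero]
    exact ENNReal.tendsto_ofReal (tendsto_scale.const_div_atTop h)
  refine tendsto_of_tendsto_of_tendsto_of_le_of_le' tendsto_const_nhds hlim
    (Eventually.of_forall fun _ => zero_le) ?_
  filter_upwards [hev, tendsto_scale.eventually_gt_atTop 0] with n hn hR
  exact hausdorffEDist_smul_le hR hn.1 hn.2.1

end LeakySandpile

end

theorem theorem1p1 (d : ℝ) (hd : 1 < d) :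
    -- convergence of the rescaled boundary, in Hausdorff distance
    Filter.Tendsto
      (fun n : ℕ => Metric.hausdorffEDist
        ((LeakySandpile.scale n)⁻¹ • LeakySandpile.latticeBoundary (LeakySandpile.visited d n))
        (LeakySandpile.limitCurve d))
      Filter.atTop (nhds 0) ∧
    -- the parametrization of the limit curve
    (LeakySandpile.limitCurve d = LeakySandpile.explicitCurve d ∧
      ∀ a ∈ Set.Icc (0 : ℝ) 1,
        HasDerivAt (LeakySandpile.S d a) 0 (LeakySandpile.wPlus d a)) ∧
    -- the unscaled boundary and region are within a constant of the curve scaled up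
    ∃ h : ℝ, 0 < h ∧ ∀ᶠ n : ℕ in Filter.atTop,
      (∀ p ∈ LeakySandpile.latticeBoundary (LeakySandpile.visited d n),
        ∃ q ∈ LeakySandpile.scale n • LeakySandpile.limitCurve d, dist p q ≤ h) ∧
      (∀ q ∈ LeakySandpile.scale n • LeakySandpile.limitCurve d,
        ∃ p ∈ LeakySandpile.latticeBoundary (LeakySandpile.visited d n), dist p q ≤ h) ∧
      (∀ (x : ℤ × ℤ) (y : LeakySandpile.Plane) (t : ℝ), y ∈ LeakySandpile.limitCurve d → 0 ≤ t →
        LeakySandpile.toPlane x = t • y →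
        (‖LeakySandpile.toPlane x‖ ≤ LeakySandpile.scale n * ‖y‖ - h →
          x ∈ LeakySandpile.visited d n) ∧
        (x ∈ LeakySandpile.visited d n →
          ‖LeakySandpile.toPlane x‖ ≤ LeakySandpile.scale n * ‖y‖ + h)) :=
  ⟨LeakySandpile.tendsto_hausdorffEDist hd,
    ⟨LeakySandpile.limitCurve_eq_explicitCurve hd,
      fun _ ha => LeakySandpile.hasDerivAt_S_wPlus hd ha⟩,
    LeakySandpile.exists_shape_const hd⟩
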